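/- **Setting.** Let $\mathcal V$ be a finite set of variables, each valued in a countable discrete space. A *causal diagram* is an acyclic directed mixed graph (ADMG) on $\mathcal V$, with directed arrows $\to$ and bidirected arrows $\leftrightarrow$. A *structural causal model* (SCM) $\mathcal M$ consists of mutually independent exogenous variables $\mathcal U$ (with arbitrary value spaces and laws) and, for each $V_i\in\mathcal V$, a parent set $\mathrm{Pa}(V_i)\subseteq\mathcal V$, a set $\mathcal U_i\subseteq\mathcal U$ and a measurable function $f_i$ giving $V_i=f_i(\mathcal U_i,\mathrm{Pa}(V_i))$, the parent relation being acyclic. Its diagram $\mathcal G_{\mathcal M}$ has $V_j\to V_i$ iff $V_j\in\mathrm{Pa}(V_i)$, and $V_i\leftrightarrow V_j$ iff $i\neq j$ and $\mathcal U_i\cap\mathcal U_j\ne\emptyset$. $P_{\mathcal M}(\mathcal V)$ is its observational distribution, and $P_{\mathcal M}(\cdot\mid \mathrm{do}(\mathbf x))$ the distribution after replacing $f_i$ by the constant $x_i$ for every $V_i\in\mathbf X$. All SCMs are taken to be positive: $P_{\mathcal M}(v)>0$ for every joint value $v$. For pairwise disjoint $\mathbf X,\mathbf Y,\mathbf Z\subseteq\mathcal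 V$ and values $\mathbf x,\mathbf y,\mathbf z$, the *query* is $Q=P(\mathbf y\mid \mathrm{do}(\mathbf x),\mathbf z)$. An *estimand* is a function $F$ from distributions on $\mathcal V$ to $\mathbb R^+$; it is *valid* for $Q$ in $\mathcal M$ if $F(P_{\mathcal M}(\mathcal V))=P_{\mathcal M}(\mathbf y\mid\mathrm{do}(\mathbf x),\mathbf z)$. Let $\mathcal C$ be a class of causal diagrams over $\mathcal V$. **Identifiability through graphs.** * *IG*: some estimand is valid for $Q$ in every SCM $\mathcal M$ with $\mathcal G_{\mathcal M}\in\mathcal C$. * *IGP* (for a given distribution $P^\star$ on $\mathcal V$): some estimand is valid for $Q$ in every SCM $\mathcal M$ with $\mathcal G_{\mathcal M}\in\mathcal C$ and $P_{\mathcal M}(\mathcal V)=P^\star$. **Do-calculus.** $\mathcal G_{\overline{\mathbf A}\underline{\mathbf B}}$ is $\mathcal G$ without the arrows having an arrowhead into $\mathbf A$ and without the directed arrows having their tail in $\mathbf B$. For pairwise disjoint $\mathbf X,\mathbf Y,\mathbf Z,\mathbf W\subseteq\mathcal V$, a *graphical independence condition* is one of the following d-separations, and it *expresses* the equality next to it,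 for all values of the variables: * R1: $\mathbf Y\perp\mathbf X\mid\mathbf W\cup\mathbf Z$ in $\mathcal G_{\overline{\mathbf W}}$; $P(\mathbf y\mid\mathrm{do}(\mathbf w),\mathbf x,\mathbf z)=P(\mathbf y\mid\mathrm{do}(\mathbf w),\mathbf z)$. * R2: $\mathbf Y\perp\mathbf X\mid\mathbf W\cup\mathbf Z$ in $\mathcal G_{\overline{\mathbf W}\,\underline{\mathbf X}}$; $P(\mathbf y\mid\mathrm{do}(\mathbf w),\mathrm{do}(\mathbf x),\mathbf z)=P(\mathbf y\mid\mathrm{do}(\mathbf w),\mathbf x,\mathbf z)$. * R3: $\mathbf Y\perp\mathbf X\mid\mathbf W\cup\mathbf Z$ in $\mathcal G_{\overline{\mathbf W},\overline{\mathbf X(\mathbf Z)}}$, where $\mathbf X(\mathbf Z)$ is the set of elements of $\mathbf X$ that are not ancestors of $\mathbf Z$ in $\mathcal G_{\overline{\mathbf W}}$; $P(\mathbf y\mid\mathrm{do}(\mathbf w),\mathrm{do}(\mathbf x),\mathbf z)=P(\mathbf y\mid\mathrm{do}(\mathbf w),\mathbf z)$. An *interventional family* assigns to every $\mathbf B\subseteq\mathcal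 V$ and value $\mathbf b$ a probability distribution $P(\mathcal V\mid\mathrm{do}(\mathbf b))$ whose atoms are exactly the joint values that agree with $\mathbf b$ on $\mathbf B$; no diagram is involved. A *formula* is built from real constants and probabilities $P(\mathbf a\mid\mathrm{do}(\mathbf b),\mathbf c)$ by $+,-,\cdot,/$ (with $x/0=0$) and sums over the values of variables (a divergent sum counting as $0$); it is *do-free* if no $\mathrm{do}$ occurs in it. A *probability manipulation* replaces a formula by one that has the same value in every interventional family. A *proof of do-calculus* is a finite sequence of probability manipulations and of applications of rules R1–R3 (replacing, inside a formula, occurrences of one side of the equality by the other), leading from $Q$ to a do-free formula. It *holds in* $\mathcal G$ if the d-separations of all the rules it applies are satisfied in $\mathcal G$. * *ICD*: there is one proof of do-calculus for $Q$ that holds in every $\mathcal G\in\mathcal C$. **Graphical criteria.** A *graphical criterion* for $Q$ is a set of graphical independence conditions together with a do-free formula which equals $Q$ in every interventional family satisfying all the equalities that these conditions express. It is *satisfied* in $\mathcal G$ if all its conditions are. A *specific* graphical criterion is a given set of graphical criteria for $Q$ (its instances, e.g. one for each choice of an adjustment set); $Q$ is identifiable by it in $\mathcal C$ if one and the same instance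 is satisfied in all $\mathcal G\in\mathcal C$. * *ICGC*: some graphical criterion for $Q$ is satisfied in all $\mathcal G\in\mathcal C$. * *ICB*: there is a set $\mathbf S$ disjoint from $\mathbf X\cup\mathbf Y\cup\mathbf Z$ that satisfies, in every $\mathcal G\in\mathcal C$, the backdoor criterion relative to $(\mathbf X,\mathbf Y\cup\mathbf Z)$: no element of $\mathbf S$ is a descendant of an element of $\mathbf X$, and $\mathbf S$ blocks every path from $\mathbf X$ to $\mathbf Y\cup\mathbf Z$ that starts with an arrow into its first vertex (a backdoor path). * *ICF*: there is a set $\mathbf S$ disjoint from $\mathbf X\cup\mathbf Y\cup\mathbf Z$ that satisfies, in every $\mathcal G\in\mathcal C$, the frontdoor criterion relative to $(\mathbf X,\mathbf Y\cup\mathbf Z)$: $\mathbf S$ intercepts all directed paths from $\mathbf X$ to $\mathbf Y\cup\mathbf Z$, every backdoor path from $\mathbf X$ to $\mathbf S$ is blocked by $\emptyset$, and every backdoor path from $\mathbf S$ to $\mathbf Y\cup\mathbf Z$ is blocked by $\mathbf X$. (For $\mathbf Z=\emptyset$ the last two are Pearl's criteria relative to $(\mathbf X,\mathbf Y)$.)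 **Theorem.** For every class $\mathcal C$ of causal diagrams over $\mathcal V$ and every query $Q=P(\mathbf y\mid\mathrm{do}(\mathbf x),\mathbf z)$: 1. if $Q$ is identifiable by a common specific graphical criterion in $\mathcal C$, then it is ICGC in $\mathcal C$; in particular ICB $\Rightarrow$ ICGC and ICF $\Rightarrow$ ICGC; 2. $Q$ is ICGC in $\mathcal C$ if and only if it is ICD in $\mathcal C$; 3. if $Q$ is ICD in $\mathcal C$, then it is IG in $\mathcal C$; 4. if $Q$ is IG in $\mathcal C$, then it is IGP in $\mathcal C$, for every distribution $P^\star$ on $\mathcal V$. -/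

import Mathlib

open MeasureTheory

universe u v w

namespace CausalId

section Graphs

/-- An acyclic directed mixed graph (causal diagram) on the vertex set `V`: directed arrows
`dir i j` (`i → j`), bidirected arrows `bi i j` (`i ↔ j`), and no directed cycle. -/
@[ext]
structure ADMG (V : Type u) where
  dir : V → V → Prop
  bi : V → V → Prop
  bi_symm : ∀ i j, bi i j → bi j i
  bi_irrefl : ∀ i, ¬ bi i i
  acyclic : ∀ i, ¬ Relation.TransGen dir i i

/-- The three ways in which an arrow can be traversed from a vertex to the next one. -/
inductive Arrow where
  | right
  | left
  | both

/-- The arrow has an arrowhead at the vertex where its traversal starts. -/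
def Arrow.HeadAtStart : Arrow → Prop
  | .right => False
  | .left => True
  | .both => True

/-- The arrow has an arrowhead at the vertex where its traversal ends. -/
def Arrow.HeadAtEnd : Arrow → Prop
  | .right => True
  | .left => False
  | .both => True

namespace ADMG

variable {V : Type u}

/-- `i` is an ancestor of `j` (equivalently `j` is a descendant of `i`); every vertex is an
ancestor of itself. -/
def IsAnc (G : ADMG V) (i j : V) : Prop := Relation.ReflTransGen G.dir i j

/-- The arrow `e`, traversed from `i` to `j`, is present in `G`. -/
def HasArrow (G : ADMG V) (i : V) (e : Arrow) (j : V) : Prop :=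
  match e with
  | .right => G.dir i j
  | .left => G.dir j i
  | .both => G.bi i j

/-- The mutilated graph: all arrows with an arrowhead into `heads` and all directed arrows with
their tail in `tails` are removed. -/
def mutilate (G : ADMG V) (heads tails : Set V) : ADMG V where
  dir i j := G.dir i j ∧ j ∉ heads ∧ i ∉ tails
  bi i j := G.bi i j ∧ i ∉ heads ∧ j ∉ heads
  bi_symm i j h := ⟨G.bi_symm i j h.1, h.2.2, h.2.1⟩
  bi_irrefl i h := G.bi_irrefl i h.1
  acyclic i h := G.acyclic i (Relation.TransGen.mono (fun _ _ hab => hab.1) _ _ h)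

/-- A path: vertices `vert 0, …, vert length`, pairwise distinct, consecutive ones being joined by
the arrows `edge 0, …, edge (length - 1)` of `G`. (Two vertices can be joined both by a directed
and by a bidirected arrow, so the arrows used are part of the path. The values of `vert` and `edge`
at larger indices play no role.) -/
structure Path (G : ADMG V) where
  length : ℕ
  vert : ℕ → V
  edge : ℕ → Arrow
  hasArrow : ∀ k, k < length → G.HasArrow (vert k) (edge k) (vert (k + 1))
  distinct : ∀ k l, k ≤ length → l ≤ length → vert k = vert l → k = l

namespace Path

variable {G : ADMG V}

/-- The first vertex of a path. -/
def first (p : G.Path) : V := p.vert 0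

/-- The last vertex of a path. -/
def last (p : G.Path) : V := p.vert p.length

/-- The `k`-th vertex is a collider on the path: it has two incoming arrows on the path. -/
def IsCollider (p : G.Path) (k : ℕ) : Prop :=
  0 < k ∧ k < p.length ∧ (p.edge (k - 1)).HeadAtEnd ∧ (p.edge k).HeadAtStart

/-- Every vertex on the path is active relative to `Z`: a collider is an ancestor of an element
of `Z`, a non-collider is not in `Z`. -/
def Active (p : G.Path) (Z : Set V) : Prop :=
  ∀ k, k ≤ p.length →
    (p.IsCollider k → ∃ z ∈ Z, G.IsAnc (p.vert k) z) ∧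
    (¬ p.IsCollider k → p.vert k ∉ Z)

/-- All arrows on the path point towards the last vertex. -/
def IsDirected (p : G.Path) : Prop := ∀ k, k < p.length → p.edge k = Arrow.right

/-- A backdoor path: it starts with an arrow into its first vertex. -/
def IsBackdoor (p : G.Path) : Prop := 0 < p.length ∧ (p.edge 0).HeadAtStart

end Path

/-- `A` and `B` are d-separated by `Z` in `G`. -/
def DSep (G : ADMG V) (A B Z : Set V) : Prop :=
  ∀ p : G.Path, p.first ∈ A → p.last ∈ B → ¬ p.Active Z

/-- The backdoor criterion for `S` relative to `(X, Y)`. -/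
def IsBackdoorSet (G : ADMG V) (X Y S : Set V) : Prop :=
  (∀ s ∈ S, ∀ x ∈ X, ¬ G.IsAnc x s) ∧
  (∀ p : G.Path, p.first ∈ X → p.last ∈ Y → p.IsBackdoor → ¬ p.Active S)

/-- The frontdoor criterion for `S` relative to `(X, Y)`. -/
def IsFrontdoorSet (G : ADMG V) (X Y S : Set V) : Prop :=
  (∀ p : G.Path, p.first ∈ X → p.last ∈ Y → p.IsDirected → ∃ k, k ≤ p.length ∧ p.vert k ∈ S) ∧
  (∀ p : G.Path, p.first ∈ X → p.last ∈ S → p.IsBackdoor → ¬ p.Active ∅) ∧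
  (∀ p : G.Path, p.first ∈ S → p.last ∈ Y → p.IsBackdoor → ¬ p.Active X)

end ADMG

end Graphs

section Models

/-- The event that the variables in `A` take the values prescribed by `a`. -/
def cyl {V : Type u} {Val : V → Type v} (A : Finset V) (a : ∀ i, Val i) : Set (∀ i, Val i) :=
  {ω | ∀ i ∈ A, ω i = a i}

/-- A structural causal model over the endogenous variables `V`, the variable `i` being valued in
`Val i`. The exogenous variables are indexed by `Exo` and mutually independent (their joint law is
the product of the `law j`); the variable `i` is a function of the exogenous variables in `exo i`
and of its parents `pa i`. -/
structure SCM (V : Type u) (Val : V → Type v) [∀ i, MeasurableSpace (Val i)] where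
  Exo : Type w
  ExoVal : Exo → Type w
  mExo : ∀ j, MeasurableSpace (ExoVal j)
  law : ∀ j, Measure (ExoVal j)
  law_prob : ∀ j, IsProbabilityMeasure (law j)
  exo : V → Set Exo
  pa : V → Finset V
  fn : ∀ i, (∀ j : exo i, ExoVal j) → (∀ k : pa i, Val k) → Val i
  fn_meas : ∀ i p, Measurable fun e => fn i e p
  acyclic : ∀ i, ¬ Relation.TransGen (fun k i => k ∈ pa i) i i

attribute [instance] SCM.mExo SCM.law_prob

namespace SCM

variable {V : Type u} {Val : V → Type v} [∀ i, MeasurableSpace (Val i)]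

/-- The causal diagram induced by the model. -/
def graph (M : SCM.{u, v, w} V Val) : ADMG V where
  dir k i := k ∈ M.pa i
  bi i j := i ≠ j ∧ (M.exo i ∩ M.exo j).Nonempty
  bi_symm i j h := ⟨h.1.symm, by rw [Set.inter_comm]; exact h.2⟩
  bi_irrefl i h := h.1 rfl
  acyclic := M.acyclic

theorem wf [Finite V] (M : SCM.{u, v, w} V Val) : WellFounded (fun k i => k ∈ M.pa i) := by
  have : Std.Irrefl (Relation.TransGen (fun k i => k ∈ M.pa i)) := ⟨M.acyclic⟩
  exact Subrelation.wf (fun h => Relation.TransGen.single h)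
    (Finite.wellFounded_of_trans_of_irrefl (Relation.TransGen (fun k i => k ∈ M.pa i)))

/-- The values of the endogenous variables under the intervention `do(B = b)`, as a
function of the exogenous variables. -/
noncomputable def solve [Finite V] [DecidableEq V] (M : SCM.{u, v, w} V Val) (B : Finset V)
    (b : ∀ i : B, Val i) (e : ∀ j, M.ExoVal j) : ∀ i, Val i :=
  M.wf.fix fun i rec =>
    if h : i ∈ B then b ⟨i, h⟩ else M.fn i (fun j => e j) (fun k => rec k k.2)

theorem solve_eq [Finite V] [DecidableEq V] (M : SCM.{u, v, w} V Val) (B : Finset V)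
    (b : ∀ i : B, Val i) (e : ∀ j, M.ExoVal j) (i : V) :
    M.solve B b e i =
      if h : i ∈ B then b ⟨i, h⟩ else M.fn i (fun j => e j) (fun k => M.solve B b e k) := by
  unfold solve
  rw [WellFounded.fix_eq]

theorem measurable_solve [Finite V] [DecidableEq V] [∀ i, Countable (Val i)]
    [∀ i, MeasurableSingletonClass (Val i)] (M : SCM.{u, v, w} V Val) (B : Finset V)
    (b : ∀ i : B, Val i) : Measurable (M.solve B b) := by
  refine measurable_pi_lambda _ fun i => ?_
  induction i using M.wf.induction with
  | _ i ih =>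
    by_cases hi : i ∈ B
    · have : (fun e => M.solve B b e i) = fun _ => b ⟨i, hi⟩ := by
        funext e; rw [solve_eq, dif_pos hi]
      rw [this]; exact measurable_const
    · have : (fun e => M.solve B b e i) =
          fun e => M.fn i (fun j => e j) (fun k => M.solve B b e k) := by
        funext e; rw [solve_eq, dif_neg hi]
      rw [this]
      have h1 : Measurable fun q : (∀ j : M.exo i, M.ExoVal j) × (∀ k : M.pa i, Val k) =>
          M.fn i q.1 q.2 := measurable_from_prod_countable_left fun p => M.fn_meas i p
      have h2 : Measurable fun e : (∀ j, M.ExoVal j) => fun j : M.exo i => e j :=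
        measurable_pi_lambda _ fun j => measurable_pi_apply _
      have h3 : Measurable fun e : (∀ j, M.ExoVal j) => fun k : M.pa i => M.solve B b e k :=
        measurable_pi_lambda _ fun k => ih k k.2
      exact h1.comp (h2.prodMk h3)

variable [Finite V] [DecidableEq V] [∀ i, Countable (Val i)] [∀ i, MeasurableSingletonClass (Val i)]

/-- The interventional distribution `P(V | do(B = b))`. -/
noncomputable def interv (M : SCM.{u, v, w} V Val) (B : Finset V) (b : ∀ i : B, Val i) :
    ProbabilityMeasure (∀ i, Val i) :=
  ⟨(Measure.infinitePi M.law).map (M.solve B b),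
    Measure.isProbabilityMeasure_map (M.measurable_solve B b).aemeasurable⟩

/-- The observational distribution `P(V)`. -/
noncomputable def obs (M : SCM.{u, v, w} V Val) : ProbabilityMeasure (∀ i, Val i) :=
  M.interv ∅ fun i => absurd i.2 (Finset.notMem_empty _)

/-- Positivity: every joint value has positive probability under the observational distribution. -/
def Positive (M : SCM.{u, v, w} V Val) : Prop :=
  ∀ a : ∀ i, Val i, 0 < (M.obs : Measure (∀ i, Val i)) {a}

/-- The value of `P(y | do(x), z)` in the model, where the values `x, y, z` are the restrictions
of `a` to `X, Y, Z`. -/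
noncomputable def condProb (M : SCM.{u, v, w} V Val) (Y X Z : Finset V) (a : ∀ i, Val i) : ℝ :=
  (ProbabilityTheory.cond (M.interv X fun i => a i : Measure (∀ i, Val i)) (cyl Z a)).real (cyl Y a)

end SCM

/-- A causal query `P(y | do(x), z)` with `X, Y, Z` pairwise disjoint; the values `x, y, z` are the
restrictions of `val` to `X, Y, Z`. -/
structure CausalQuery (V : Type u) (Val : V → Type v) where
  X : Finset V
  Y : Finset V
  Z : Finset V
  disj_XY : Disjoint X Y
  disj_XZ : Disjoint X Z
  disj_YZ : Disjoint Y Z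
  val : ∀ i, Val i

end Models

section Estimands

variable {V : Type u} [Finite V] [DecidableEq V] {Val : V → Type v} [∀ i, Countable (Val i)]
  [∀ i, MeasurableSpace (Val i)] [∀ i, MeasurableSingletonClass (Val i)]

/-- The causal estimand `F` is valid for the query in the model. -/
def ValidIn (F : ProbabilityMeasure (∀ i, Val i) → NNReal) (Q : CausalQuery V Val)
    (M : SCM.{u, v, w} V Val) : Prop :=
  (F M.obs : ℝ) = M.condProb Q.Y Q.X Q.Z Q.val

/-- Identifiability through graphs (IG). -/
def IG (C : Set (ADMG V)) (Q : CausalQuery V Val) : Prop :=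
  ∃ F : ProbabilityMeasure (∀ i, Val i) → NNReal,
    ∀ M : SCM.{u, v, w} V Val, M.Positive → M.graph ∈ C → ValidIn F Q M

/-- Identifiability through graphs knowing the observational distribution `P` (IGP). -/
def IGP (P : ProbabilityMeasure (∀ i, Val i)) (C : Set (ADMG V)) (Q : CausalQuery V Val) : Prop :=
  ∃ F : ProbabilityMeasure (∀ i, Val i) → NNReal,
    ∀ M : SCM.{u, v, w} V Val, M.Positive → M.graph ∈ C → M.obs = P → ValidIn F Q M

end Estimands

section DoCalculus

/-- Formal expressions built from interventional conditional probabilities. The atom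
`prob A B C a` is `P(a_A | do(a_B), a_C)`, where `a_A` is the restriction of `a` to `A`; the
expression `sum S f` is the sum of `f s` over all joint values `s` of the variables in `S`. -/
inductive Expr (V : Type u) (Val : V → Type v) : Type (max u v) where
  | const (c : ℝ) : Expr V Val
  | prob (A B C : Finset V) (a : ∀ i, Val i) : Expr V Val
  | add (s t : Expr V Val) : Expr V Val
  | sub (s t : Expr V Val) : Expr V Val
  | mul (s t : Expr V Val) : Expr V Val
  | div (s t : Expr V Val) : Expr V Val
  | sum (S : Finset V) (f : (∀ i : S, Val i) → Expr V Val) : Expr V Val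

/-- The expression involves the distribution without intervention only. -/
def Expr.DoFree {V : Type u} {Val : V → Type v} : Expr V Val → Prop
  | .const _ => True
  | .prob _ B _ _ => B = ∅
  | .add s t => s.DoFree ∧ t.DoFree
  | .sub s t => s.DoFree ∧ t.DoFree
  | .mul s t => s.DoFree ∧ t.DoFree
  | .div s t => s.DoFree ∧ t.DoFree
  | .sum _ f => ∀ s, (f s).DoFree

/-- The query as a formal expression. -/
def CausalQuery.expr {V : Type u} {Val : V → Type v} (Q : CausalQuery V Val) : Expr V Val :=
  .prob Q.Y Q.X Q.Z Q.val

/-- A family of interventional distributions, not tied to any diagram: for every `B` and every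
value `b` of the variables in `B` a distribution `P(V | do(b))` under which exactly the joint values
that agree with `b` on `B` have positive probability. -/
structure IntervFamily (V : Type u) (Val : V → Type v) [∀ i, MeasurableSpace (Val i)] where
  dist : ∀ B : Finset V, (∀ i : B, Val i) → ProbabilityMeasure (∀ i, Val i)
  pos_iff : ∀ (B : Finset V) (b : ∀ i : B, Val i) (a : ∀ i, Val i),
    0 < (dist B b : Measure (∀ i, Val i)) {a} ↔ ∀ i : B, a i = b i

/-- The value of an expression for a family of interventional distributions. -/
noncomputable def Expr.eval {V : Type u} {Val : V → Type v} [∀ i, MeasurableSpace (Val i)]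
    (D : IntervFamily V Val) : Expr V Val → ℝ
  | .const c => c
  | .prob A B C a =>
      (ProbabilityTheory.cond (D.dist B fun i => a i : Measure (∀ i, Val i)) (cyl C a)).real
        (cyl A a)
  | .add s t => s.eval D + t.eval D
  | .sub s t => s.eval D - t.eval D
  | .mul s t => s.eval D * t.eval D
  | .div s t => s.eval D / t.eval D
  | .sum _ f => ∑' s, (f s).eval D

/-- A manipulation licensed by probability theory alone: the two expressions have the same value
for every family of interventional distributions. -/
def ProbEq {V : Type u} {Val : V → Type v} [∀ i, MeasurableSpace (Val i)]
    (s t : Expr V Val) : Prop :=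
  ∀ D : IntervFamily V Val, s.eval D = t.eval D

/-- The three types of rules of do-calculus. -/
inductive RuleKind where
  | R1
  | R2
  | R3

/-- A graphical independence condition: one of the three do-calculus rules together with pairwise
disjoint sets of variables. -/
structure IndepCond (V : Type u) where
  kind : RuleKind
  X : Finset V
  Y : Finset V
  Z : Finset V
  W : Finset V
  disj_XY : Disjoint X Y
  disj_XZ : Disjoint X Z
  disj_XW : Disjoint X W
  disj_YZ : Disjoint Y Z
  disj_YW : Disjoint Y W
  disj_ZW : Disjoint Z W

namespace IndepCond

variable {V : Type u}

/-- The mutilated graph in which the d-separation has to hold. -/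
def mutilated (r : IndepCond V) (G : ADMG V) : ADMG V :=
  match r.kind with
  | .R1 => G.mutilate r.W ∅
  | .R2 => G.mutilate r.W r.X
  | .R3 => G.mutilate (r.W ∪ {x | x ∈ r.X ∧ ∀ z ∈ r.Z, ¬ (G.mutilate r.W ∅).IsAnc x z}) ∅

/-- The condition is satisfied in the diagram: `Y` and `X` are d-separated by `W ∪ Z` in the
mutilated graph. -/
def HoldsIn (r : IndepCond V) (G : ADMG V) : Prop :=
  (r.mutilated G).DSep r.Y r.X (r.W ∪ r.Z)

variable [DecidableEq V] {Val : V → Type v}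

/-- Left-hand side of the equality of the rule: `P(y | do(w), x, z)` for R1 and
`P(y | do(w), do(x), z)` for R2 and R3. -/
def lhs (r : IndepCond V) (a : ∀ i, Val i) : Expr V Val :=
  match r.kind with
  | .R1 => .prob r.Y r.W (r.X ∪ r.Z) a
  | .R2 => .prob r.Y (r.W ∪ r.X) r.Z a
  | .R3 => .prob r.Y (r.W ∪ r.X) r.Z a

/-- Right-hand side of the equality of the rule: `P(y | do(w), z)` for R1 and R3 and
`P(y | do(w), x, z)` for R2. -/
def rhs (r : IndepCond V) (a : ∀ i, Val i) : Expr V Val :=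
  match r.kind with
  | .R1 => .prob r.Y r.W r.Z a
  | .R2 => .prob r.Y r.W (r.X ∪ r.Z) a
  | .R3 => .prob r.Y r.W r.Z a

/-- The family of distributions has the invariance that the condition expresses, at all values. -/
def HoldsFor [∀ i, MeasurableSpace (Val i)] (r : IndepCond V) (D : IntervFamily V Val) : Prop :=
  ∀ a : ∀ i, Val i, (r.lhs a).eval D = (r.rhs a).eval D

end IndepCond

variable {V : Type u} [DecidableEq V] {Val : V → Type v}

/-- `Rewrite r s t`: the expression `t` results from `s` by applying the rule `r`, in either
direction, to some of the probabilities that occur in `s`. -/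
inductive Rewrite (r : IndepCond V) : Expr V Val → Expr V Val → Prop
  | refl (t : Expr V Val) : Rewrite r t t
  | forward (a : ∀ i, Val i) : Rewrite r (r.lhs a) (r.rhs a)
  | backward (a : ∀ i, Val i) : Rewrite r (r.rhs a) (r.lhs a)
  | add {s s' t t' : Expr V Val} : Rewrite r s s' → Rewrite r t t' →
      Rewrite r (.add s t) (.add s' t')
  | sub {s s' t t' : Expr V Val} : Rewrite r s s' → Rewrite r t t' →
      Rewrite r (.sub s t) (.sub s' t')
  | mul {s s' t t' : Expr V Val} : Rewrite r s s' → Rewrite r t t' →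
      Rewrite r (.mul s t) (.mul s' t')
  | div {s s' t t' : Expr V Val} : Rewrite r s s' → Rewrite r t t' →
      Rewrite r (.div s t) (.div s' t')
  | sum {S : Finset V} {f g : (∀ i : S, Val i) → Expr V Val} : (∀ s, Rewrite r (f s) (g s)) →
      Rewrite r (.sum S f) (.sum S g)

variable [∀ i, MeasurableSpace (Val i)]

/-- A proof of do-calculus: a finite sequence of applications of the do-calculus rules and of
probability manipulations that transforms the first expression into the second one. -/
inductive DoProof : Expr V Val → Expr V Val → Type (max u v)
  | done (t : Expr V Val) : DoProof t t
  | rule {s t t' : Expr V Val} (r : IndepCond V) (h : Rewrite r s t) (p : DoProof t t') :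
      DoProof s t'
  | prob {s t t' : Expr V Val} (h : ProbEq s t) (p : DoProof t t') : DoProof s t'

/-- The proof holds in the diagram: the conditions of all rule applications are satisfied in it. -/
def DoProof.HoldsIn {s t : Expr V Val} (p : DoProof s t) (G : ADMG V) : Prop :=
  match p with
  | .done _ => True
  | .rule r _ q => r.HoldsIn G ∧ q.HoldsIn G
  | .prob _ q => q.HoldsIn G

/-- Identifiability by common do-calculus (ICD). -/
def ICD (C : Set (ADMG V)) (Q : CausalQuery V Val) : Prop :=
  ∃ t : Expr V Val, t.DoFree ∧ ∃ p : DoProof Q.expr t, ∀ G ∈ C, p.HoldsIn G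

/-- A graphical criterion for the query: a set of graphical independence conditions together with
a formula in terms of the observational distribution, such that the formula gives the query in every
family of interventional distributions which has the invariances that the conditions express. -/
structure GraphicalCriterion (Q : CausalQuery V Val) where
  conds : Set (IndepCond V)
  formula : Expr V Val
  doFree : formula.DoFree
  sound : ∀ D : IntervFamily V Val, (∀ r ∈ conds, r.HoldsFor D) →
    Q.expr.eval D = formula.eval D

/-- The criterion is satisfied in the diagram. -/
def GraphicalCriterion.SatisfiedIn {Q : CausalQuery V Val} (K : GraphicalCriterion Q)
    (G : ADMG V) : Prop :=
  ∀ r ∈ K.conds, r.HoldsIn G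

/-- Identifiability by common graphical criterion (ICGC). -/
def ICGC (C : Set (ADMG V)) (Q : CausalQuery V Val) : Prop :=
  ∃ K : GraphicalCriterion Q, ∀ G ∈ C, K.SatisfiedIn G

/-- Identifiability by a common specific graphical criterion: a specific criterion consists of its
instances (one for each choice of an adjustment set, say), and one and the same instance is
satisfied in all diagrams. -/
def IdentByCommonSpecific (C : Set (ADMG V)) (Q : CausalQuery V Val)
    (𝒦 : Set (GraphicalCriterion Q)) : Prop :=
  ∃ K ∈ 𝒦, ∀ G ∈ C, K.SatisfiedIn G

/-- Identifiability by common backdoor (ICB): one and the same set satisfies the backdoor criterion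
relative to `(X, Y ∪ Z)` in all diagrams. -/
def ICB {Val : V → Type v} (C : Set (ADMG V)) (Q : CausalQuery V Val) : Prop :=
  ∃ S : Finset V, Disjoint S (Q.X ∪ Q.Y ∪ Q.Z) ∧
    ∀ G ∈ C, G.IsBackdoorSet Q.X (Q.Y ∪ Q.Z) S

/-- Identifiability by common frontdoor (ICF): one and the same set satisfies the frontdoor
criterion relative to `(X, Y ∪ Z)` in all diagrams. -/
def ICF {Val : V → Type v} (C : Set (ADMG V)) (Q : CausalQuery V Val) : Prop :=
  ∃ S : Finset V, Disjoint S (Q.X ∪ Q.Y ∪ Q.Z) ∧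
    ∀ G ∈ C, G.IsFrontdoorSet Q.X (Q.Y ∪ Q.Z) S

end DoCalculus

end CausalId

/-! The substance lies in three places: soundness of R1–R3 in positive models, the passage from a
criterion to a derivation, and the backdoor and frontdoor formulas. The other implications repackage
data.

Soundness rests on the global Markov property `SCM.obs_agree_mul`. On the ancestral set of `X ∪ Y ∪
Z`, a joint value has the probability that all structural equations of this set hold at it. By
`ADMG.DSep.exists_split`, d-separation splits these equations into two groups that share no
exogenous variable and whose endogenous variables overlap only in `Z`. The marginal is then a
product of two factors overlapping only in `Z`, which gives conditional independence. To reach the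
rules, the mutilated graph is realised as the diagram of a model, `SCM.swig`: `W` is set to
constants, and constants replace `X` wherever it is an argument, while `X` keeps its own equations.
Events prescribing `X` have their `do(W)` probability there, events not mentioning `X` their `do(W ∪
X)` probability. The Markov property of this model is R1 (nothing substituted) or R2; R3 follows
from both, because an intervention does not affect non-descendants. A do-free formula depends only
on the observational distribution, so a criterion determines the query from it.

Collecting the rules of a derivation gives a criterion. Conversely, a criterion is only a semantic
implication, and a derivation has to be made from it (`exists_doProof_of_conds`). The failure of a
rule `r` is encoded in a formula `δ` that vanishes exactly when `r` holds. If `r` forces `s = t`,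
then `s` equals `t + (s - t) * (δ / δ)` always, since `0 / 0 = 0`. Applying `r` inside `δ` makes it
identically zero, and `t` remains. Rules are eliminated in this way one at a time; there are
finitely many.

For backdoor and frontdoor sets, the query is the quotient of `P(y, z | do(x))` by `P(z | do(x))`,
and the classical formula is applied to both. -/

namespace CausalId

/-! ### Active walks and their reduction to active paths. -/

section ActiveWalks

variable {V : Type u}

/-- The arrow `e` arriving at a vertex and the arrow `f` leaving it form a collider there. -/
def Arrow.Collide (e f : Arrow) : Prop := e.HeadAtEnd ∧ f.HeadAtStart

namespace ADMG

/-- Vertices `v` that can be reached from `A` along a walk all of whose vertices before `v` are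
active relative to `Z`, the arrow `e` being the last one of the walk. A walk without arrows counts
as arriving through an arrow without arrowhead. -/
inductive Reach (G : ADMG V) (A Z : Set V) : V → Arrow → Prop
  | start {a : V} (ha : a ∈ A) : Reach G A Z a .left
  | step {i j : V} {e f : Arrow} (h : Reach G A Z i e) (hf : G.HasArrow i f j)
      (hc : e.Collide f → ∃ z ∈ Z, G.IsAnc i z) (hn : ¬ e.Collide f → i ∉ Z) : Reach G A Z j f

/-- An active walk with vertices `vert 0, …, vert n`, the arrow `inc k` arriving at the `k`-th
vertex; fictitious arrows without arrowheads at the walk are added at both ends. -/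
structure ActiveWalk (G : ADMG V) (Z : Set V) (n : ℕ) (vert : ℕ → V) (inc : ℕ → Arrow) : Prop where
  start : inc 0 = .left
  finish : inc (n + 1) = .right
  arrow : ∀ k < n, G.HasArrow (vert k) (inc (k + 1)) (vert (k + 1))
  collider : ∀ k ≤ n, (inc k).Collide (inc (k + 1)) → ∃ z ∈ Z, G.IsAnc (vert k) z
  nonCollider : ∀ k ≤ n, ¬ (inc k).Collide (inc (k + 1)) → vert k ∉ Z

theorem Reach.exists_walk {G : ADMG V} {A Z : Set V} {v : V} {e : Arrow} (h : G.Reach A Z v e) :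
    ∃ (n : ℕ) (vert : ℕ → V) (inc : ℕ → Arrow), vert 0 ∈ A ∧ vert n = v ∧ inc 0 = .left ∧
      inc n = e ∧ (∀ k < n, G.HasArrow (vert k) (inc (k + 1)) (vert (k + 1))) ∧
      (∀ k < n, (inc k).Collide (inc (k + 1)) → ∃ z ∈ Z, G.IsAnc (vert k) z) ∧
      (∀ k < n, ¬ (inc k).Collide (inc (k + 1)) → vert k ∉ Z) := by
  induction h with
  | @start a ha =>
    exact ⟨0, fun _ => a, fun _ => .left, ha, rfl, rfl, rfl, by simp, by simp, by simp⟩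
  | @step i j e f h hf hc hn ih =>
    obtain ⟨n, vert, inc, h0, hv, hs, he, harr, hcol, hnon⟩ := ih
    refine ⟨n + 1, fun k => if k ≤ n then vert k else j, fun k => if k ≤ n then inc k else f,
      by simpa using h0, by simp, by simpa using hs, by simp, ?_, ?_, ?_⟩ <;> intro k hk <;>
      have hk' : k ≤ n := by omega
    all_goals
      rcases hk'.lt_or_eq with h1 | h1
      · have h2 : k + 1 ≤ n := h1
        simp only [hk', h2, if_true]
        first | exact harr k h1 | exact hcol k h1 | exact hnon k h1
      · subst h1
        simp only [le_refl, if_true, Nat.not_succ_le_self, if_false, hv, he]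
        first | exact hf | exact hc | exact hn

/-- `Reach` leaves the last vertex unconstrained. The closing fictitious arrow makes it a
non-collider, whence the condition `v ∉ Z`. -/
theorem Reach.exists_activeWalk {G : ADMG V} {A Z : Set V} {v : V} {e : Arrow}
    (h : G.Reach A Z v e) (hv : v ∉ Z) :
    ∃ n vert inc, G.ActiveWalk Z n vert inc ∧ vert 0 ∈ A ∧ vert n = v := by
  obtain ⟨n, vert, inc, h0, hn, hs, -, harr, hcol, hnon⟩ := h.exists_walk
  refine ⟨n, vert, fun k => if k ≤ n then inc k else .right,
    ⟨by simpa using hs, by simp, ?_, ?_, ?_⟩,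
    h0, hn⟩
  · intro k hk
    have h2 : k + 1 ≤ n := hk
    simpa [h2] using harr k hk
  · intro k hk
    rcases hk.lt_or_eq with h1 | h1
    · have h2 : k + 1 ≤ n := h1
      simpa [hk, h2] using hcol k h1
    · subst h1
      simp [Arrow.Collide, Arrow.HeadAtStart]
  · intro k hk
    rcases hk.lt_or_eq with h1 | h1
    · have h2 : k + 1 ≤ n := h1
      simpa [hk, h2] using hnon k h1
    · subst h1
      intro _
      rwa [hn]

theorem _root_.CausalId.Arrow.eq_right_of_not_headAtStart {e : Arrow} (h : ¬ e.HeadAtStart) :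
    e = .right := by
  cases e <;> simp_all [Arrow.HeadAtStart]

theorem _root_.CausalId.Arrow.eq_left_of_not_headAtEnd {e : Arrow} (h : ¬ e.HeadAtEnd) :
    e = .left := by
  cases e <;> simp_all [Arrow.HeadAtEnd]

/-- Between a departure along an outgoing directed arrow and an arrival against an outgoing directed
arrow there is a collider, of which the departure vertex is an ancestor. -/
theorem ActiveWalk.isAnc_of_tails {G : ADMG V} {Z : Set V} {n : ℕ} {vert : ℕ → V} {inc : ℕ → Arrow}
    (W : G.ActiveWalk Z n vert inc) {k l : ℕ} (hkl : k < l) (hln : l ≤ n)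
    (hk : inc (k + 1) = .right) (hl : inc l = .left) : ∃ z ∈ Z, G.IsAnc (vert k) z := by
  by_contra hcon
  have key : ∀ m, k + 1 ≤ m → m ≤ l → inc m = .right ∧ G.IsAnc (vert k) (vert m) := by
    intro m hm
    induction m, hm using Nat.le_induction with
    | base =>
      intro h
      have := W.arrow k (by omega)
      rw [hk] at this
      exact ⟨hk, Relation.ReflTransGen.single this⟩
    | succ m hm ih =>
      intro h
      obtain ⟨h1, h2⟩ := ih (by omega)
      by_cases h3 : (inc (m + 1)).HeadAtStart
      · obtain ⟨z, hz, hz'⟩ := W.collider m (by omega) ⟨by rw [h1]; trivial, h3⟩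
        exact absurd ⟨z, hz, h2.trans hz'⟩ hcon
      · have h4 := Arrow.eq_right_of_not_headAtStart h3
        have := W.arrow m (by omega)
        rw [h4] at this
        exact ⟨h4, h2.tail this⟩
  have := (key l hkl le_rfl).1
  rw [hl] at this
  cases this

/-- A repeated vertex of an active walk can be used to shorten the walk. -/
theorem ActiveWalk.shortcut {G : ADMG V} {Z : Set V} {n : ℕ} {vert : ℕ → V} {inc : ℕ → Arrow}
    (W : G.ActiveWalk Z n vert inc) {k l : ℕ} (hkl : k < l) (hln : l ≤ n)
    (hv : vert k = vert l) :
    G.ActiveWalk Z (n - (l - k)) (fun j => if j ≤ k then vert j else vert (j + (l - k)))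
      (fun j => if j ≤ k then inc j else inc (j + (l - k))) := by
  have hkl' : k + (l - k) = l := by omega
  have hkl'' : k + 1 + (l - k) = l + 1 := by omega
  refine ⟨?_, ?_, ?_, ?_, ?_⟩
  · simpa using W.start
  · have h1 : ¬ (n - (l - k) + 1 ≤ k) := by omega
    have h2 : n - (l - k) + 1 + (l - k) = n + 1 := by omega
    simpa only [h1, if_false, h2] using W.finish
  · intro j hj
    rcases lt_trichotomy j k with h | h | h
    · have h1 : j + 1 ≤ k := h
      simpa only [h.le, h1, if_true] using W.arrow j (by omega)
    · subst h
      have h1 : ¬ (j + 1 ≤ j) := by omega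
      simp only [le_refl, h1, if_true, if_false, hkl'', hv]
      exact W.arrow l (by omega)
    · have h1 : ¬ j ≤ k := by omega
      have h2 : ¬ j + 1 ≤ k := by omega
      have h3 : j + 1 + (l - k) = j + (l - k) + 1 := by omega
      simp only [h1, h2, if_false, h3]
      exact W.arrow _ (by omega)
  · intro j hj
    rcases lt_trichotomy j k with h | h | h
    · have h1 : j + 1 ≤ k := h
      simpa only [h.le, h1, if_true] using W.collider j (by omega)
    · subst h
      have h1 : ¬ (j + 1 ≤ j) := by omega
      simp only [le_refl, h1, if_true, if_false, hkl'']
      intro hc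
      by_cases hk : (inc j).Collide (inc (j + 1))
      · exact W.collider j (by omega) hk
      by_cases hl : (inc l).Collide (inc (l + 1))
      · rw [hv]; exact W.collider l (by omega) hl
      -- The merged vertex is a collider although neither occurrence was one: the removed loop
      -- leaves it by a tail and returns by a tail, so the loop contains an active collider below
      -- it.
      refine W.isAnc_of_tails hkl hln (Arrow.eq_right_of_not_headAtStart fun h => hk ⟨hc.1, h⟩)
        (Arrow.eq_left_of_not_headAtEnd fun h => hl ⟨h, hc.2⟩)
    · have h1 : ¬ j ≤ k := by omega
      have h2 : ¬ j + 1 ≤ k := by omega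
      have h3 : j + 1 + (l - k) = j + (l - k) + 1 := by omega
      simp only [h1, h2, if_false, h3]
      exact W.collider _ (by omega)
  · intro j hj
    rcases lt_trichotomy j k with h | h | h
    · have h1 : j + 1 ≤ k := h
      simpa only [h.le, h1, if_true] using W.nonCollider j (by omega)
    · subst h
      have h1 : ¬ (j + 1 ≤ j) := by omega
      simp only [le_refl, h1, if_true, if_false, hkl'']
      intro hc
      by_cases hk : (inc j).Collide (inc (j + 1))
      · by_cases hl : (inc l).Collide (inc (l + 1))
        · exact absurd ⟨hk.1, hl.2⟩ hc
        · rw [hv]; exact W.nonCollider l (by omega) hl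
      · exact W.nonCollider j (by omega) hk
    · have h1 : ¬ j ≤ k := by omega
      have h2 : ¬ j + 1 ≤ k := by omega
      have h3 : j + 1 + (l - k) = j + (l - k) + 1 := by omega
      simp only [h1, h2, if_false, h3]
      exact W.nonCollider _ (by omega)

/-- Loops are cut out by induction on the length. The fictitious arrows make both ends
non-colliders, in accordance with the bounds `0 < k` and `k < p.length` in `Path.IsCollider`. -/
theorem ActiveWalk.exists_path {G : ADMG V} {Z : Set V} {n : ℕ} {vert : ℕ → V} {inc : ℕ → Arrow}
    (W : G.ActiveWalk Z n vert inc) :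
    ∃ p : G.Path, p.first = vert 0 ∧ p.last = vert n ∧ p.Active Z := by
  induction n using Nat.strong_induction_on generalizing vert inc with
  | _ n ih =>
    by_cases hd : ∃ k l, k < l ∧ l ≤ n ∧ vert k = vert l
    · obtain ⟨k, l, hkl, hln, hv⟩ := hd
      obtain ⟨p, hp0, hp1, hp⟩ := ih _ (by omega) (W.shortcut hkl hln hv)
      refine ⟨p, by simpa using hp0, ?_, hp⟩
      rw [hp1]
      by_cases h : n - (l - k) ≤ k
      · have h1 : n = l := by omega
        have h2 : n - (l - k) = k := by omega
        rw [if_pos h, h2, hv, h1]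
      · rw [if_neg h]
        congr 1
        omega
    · refine ⟨⟨n, vert, fun k => inc (k + 1), W.arrow, ?_⟩, rfl, rfl, ?_⟩
      · intro k l hk hl h
        rcases lt_trichotomy k l with h1 | h1 | h1
        · exact absurd ⟨k, l, h1, hl, h⟩ hd
        · exact h1
        · exact absurd ⟨l, k, h1, hk, h.symm⟩ hd
      · intro k hk
        change k ≤ n at hk
        have : (0 < k ∧ k < n ∧ (inc (k - 1 + 1)).HeadAtEnd ∧ (inc (k + 1)).HeadAtStart) ↔
            (inc k).Collide (inc (k + 1)) := by
          constructor
          · rintro ⟨h0, -, h1, h2⟩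
            rw [Nat.sub_add_cancel h0] at h1
            exact ⟨h1, h2⟩
          · rintro ⟨h1, h2⟩
            have h0 : 0 < k := by
              rcases Nat.eq_zero_or_pos k with h | h
              · rw [h, W.start] at h1; exact h1.elim
              · exact h
            refine ⟨h0, ?_, by rwa [Nat.sub_add_cancel h0], h2⟩
            rcases hk.lt_or_eq with h | h
            · exact h
            · rw [h, W.finish] at h2; exact h2.elim
        refine ⟨fun hc => W.collider k hk (this.1 hc),
          fun hc => W.nonCollider k hk fun h => hc (this.2 h)⟩

/-- The form in which d-separation is used from here on: walks may be extended freely, without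
keeping their vertices distinct. -/
theorem DSep.not_reach {G : ADMG V} {A B Z : Set V} (h : G.DSep A B Z) {b : V} {e : Arrow}
    (hb : b ∈ B) (hbZ : b ∉ Z) : ¬ G.Reach A Z b e := by
  intro hr
  obtain ⟨n, vert, inc, W, h0, hn⟩ := hr.exists_activeWalk hbZ
  obtain ⟨p, hp0, hp1, hp⟩ := W.exists_path
  exact h p (hp0 ▸ h0) (hp1 ▸ hn ▸ hb) hp

theorem IsAnc.mono {G H : ADMG V} (hd : ∀ i j, H.dir i j → G.dir i j) {i j : V} (h : H.IsAnc i j) :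
    G.IsAnc i j :=
  Relation.ReflTransGen.mono hd _ _ h

theorem HasArrow.mono {G H : ADMG V} (hd : ∀ i j, H.dir i j → G.dir i j)
    (hb : ∀ i j, H.bi i j → G.bi i j) {i j : V} {e : Arrow} (h : H.HasArrow i e j) :
    G.HasArrow i e j := by
  cases e
  · exact hd _ _ h
  · exact hd _ _ h
  · exact hb _ _ h

/-- A path of a subgraph, as a path of the graph. -/
def Path.map {G H : ADMG V} (hd : ∀ i j, H.dir i j → G.dir i j) (hb : ∀ i j, H.bi i j → G.bi i j)
    (p : H.Path) : G.Path where
  length := p.length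
  vert := p.vert
  edge := p.edge
  hasArrow k hk := (p.hasArrow k hk).mono hd hb
  distinct := p.distinct

theorem Path.Active.map {G H : ADMG V} (hd : ∀ i j, H.dir i j → G.dir i j)
    (hb : ∀ i j, H.bi i j → G.bi i j) {p : H.Path} {Z : Set V} (h : p.Active Z) :
    (p.map hd hb).Active Z := by
  intro k hk
  refine ⟨fun hc => ?_, (h k hk).2⟩
  obtain ⟨z, hz, hz'⟩ := (h k hk).1 hc
  exact ⟨z, hz, hz'.mono hd⟩

theorem DSep.anti {G H : ADMG V} (hd : ∀ i j, H.dir i j → G.dir i j)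
    (hb : ∀ i j, H.bi i j → G.bi i j) {A B Z : Set V} (h : G.DSep A B Z) : H.DSep A B Z :=
  fun p h0 h1 ha => h (p.map hd hb) h0 h1 (ha.map hd hb)

theorem DSep.mono {G : ADMG V} {A A' B B' Z : Set V} (h : G.DSep A B Z) (hA : A' ⊆ A)
    (hB : B' ⊆ B) : G.DSep A' B' Z :=
  fun p h0 h1 => h p (hA h0) (hB h1)

/-- The arrow traversed in the opposite direction. -/
def _root_.CausalId.Arrow.reverse : Arrow → Arrow
  | .right => .left
  | .left => .right
  | .both => .both

theorem _root_.CausalId.Arrow.headAtStart_reverse (e : Arrow) :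
    e.reverse.HeadAtStart ↔ e.HeadAtEnd := by
  cases e <;> rfl

theorem _root_.CausalId.Arrow.headAtEnd_reverse (e : Arrow) :
    e.reverse.HeadAtEnd ↔ e.HeadAtStart := by
  cases e <;> rfl

theorem HasArrow.reverse {G : ADMG V} {i j : V} {e : Arrow} (h : G.HasArrow i e j) :
    G.HasArrow j e.reverse i := by
  cases e
  · exact h
  · exact h
  · exact G.bi_symm _ _ h

/-- The path traversed in the opposite direction. -/
def Path.reverse {G : ADMG V} (p : G.Path) : G.Path where
  length := p.length
  vert k := p.vert (p.length - k)
  edge k := (p.edge (p.length - (k + 1))).reverse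
  hasArrow k hk := by
    have := (p.hasArrow (p.length - (k + 1)) (by omega)).reverse
    rwa [show p.length - (k + 1) + 1 = p.length - k by omega] at this
  distinct k l hk hl h := by
    have := p.distinct _ _ (Nat.sub_le _ _) (Nat.sub_le _ _) h
    omega

theorem Path.last_reverse {G : ADMG V} (p : G.Path) : p.reverse.last = p.first := by
  simp [Path.last, Path.first, Path.reverse]

theorem Path.isCollider_reverse {G : ADMG V} (p : G.Path) {k : ℕ} (hk : k ≤ p.length) :
    p.reverse.IsCollider k ↔ p.IsCollider (p.length - k) := by
  unfold Path.IsCollider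
  change 0 < k ∧ k < p.length ∧ (p.edge (p.length - (k - 1 + 1))).reverse.HeadAtEnd ∧
    (p.edge (p.length - (k + 1))).reverse.HeadAtStart ↔ _
  rw [Arrow.headAtStart_reverse, Arrow.headAtEnd_reverse]
  constructor
  · rintro ⟨h1, h2, h3, h4⟩
    rw [show k - 1 + 1 = k by omega] at h3
    exact ⟨by omega, by omega, by rwa [show p.length - k - 1 = p.length - (k + 1) by omega], h3⟩
  · rintro ⟨h1, h2, h3, h4⟩
    rw [show p.length - k - 1 = p.length - (k + 1) by omega] at h3
    exact ⟨by omega, by omega, by rwa [show k - 1 + 1 = k by omega], h3⟩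

theorem Path.Active.reverse {G : ADMG V} {p : G.Path} {Z : Set V} (h : p.Active Z) :
    p.reverse.Active Z := by
  intro k hk
  rw [p.isCollider_reverse hk]
  exact h (p.length - k) (Nat.sub_le _ _)

theorem DSep.symm {G : ADMG V} {A B Z : Set V} (h : G.DSep A B Z) : G.DSep B A Z :=
  fun p h0 h1 ha => h p.reverse h1 (p.last_reverse ▸ h0) ha.reverse

end ADMG

end ActiveWalks

end CausalId

namespace CausalId

/-! ### Splitting the ancestral set along a d-separation. -/

section Separation

variable {V : Type u}

namespace ADMG

theorem Reach.exists_of_isAnc {G : ADMG V} {A Z : Set V} {v y : V} {e : Arrow}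
    (h : G.Reach A Z v e) (hv : ¬ ∃ z ∈ Z, G.IsAnc v z) (hy : G.IsAnc v y) :
    ∃ f, G.Reach A Z y f := by
  induction hy using Relation.ReflTransGen.head_induction_on generalizing e with
  | refl => exact ⟨e, h⟩
  | head hd _ ih =>
    refine ih (h.step (f := .right) hd (fun hc => hc.2.elim) fun _ hz => ?_) ?_
    · exact hv ⟨_, hz, Relation.ReflTransGen.refl⟩
    · rintro ⟨z, hz, hz'⟩
      exact hv ⟨z, hz, hz'.head hd⟩

/-- The directed path is walked backwards from `a`. Arriving by a tail, the walk can leave `v` by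
any arrow, since `v` is then a non-collider. -/
theorem reach_left_of_isAnc {G : ADMG V} {A Z : Set V} {v a : V} (ha : a ∈ A)
    (hv : ¬ ∃ z ∈ Z, G.IsAnc v z) (h : G.IsAnc v a) : G.Reach A Z v .left := by
  induction h using Relation.ReflTransGen.head_induction_on with
  | refl => exact .start ha
  | head hd _ ih =>
    have hv' : ¬ ∃ z ∈ Z, G.IsAnc _ z := fun ⟨z, hz, hz'⟩ => hv ⟨z, hz, hz'.head hd⟩
    exact (ih hv').step (f := .left) hd (fun hc => hc.1.elim)
      fun _ hz => hv' ⟨_, hz, Relation.ReflTransGen.refl⟩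

/-- The vertices whose structural equation is linked to `X` by a chain of equations of variables in
`A` that share an exogenous variable or a variable outside `Z`. -/
inductive Linked (G : ADMG V) (X Z A : Set V) : V → Prop
  | start {x : V} (hx : x ∈ X) : Linked G X Z A x
  | bi {i j : V} (h : Linked G X Z A i) (hb : G.bi i j) (hj : j ∈ A) : Linked G X Z A j
  | parent {i j : V} (h : Linked G X Z A i) (hd : G.dir j i) (hj : j ∉ Z) : Linked G X Z A j
  | child {i j : V} (h : Linked G X Z A i) (hi : i ∉ Z) (hd : G.dir i j) (hj : j ∈ A) :
      Linked G X Z A j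

/-- The ancestors of elements of `S`. -/
def ancestors (G : ADMG V) (S : Set V) : Set V := {i | ∃ s ∈ S, G.IsAnc i s}

theorem subset_ancestors (G : ADMG V) (S : Set V) : S ⊆ G.ancestors S :=
  fun s hs => ⟨s, hs, Relation.ReflTransGen.refl⟩

theorem mem_ancestors_of_dir {G : ADMG V} {S : Set V} {i j : V} (h : G.dir i j)
    (hj : j ∈ G.ancestors S) : i ∈ G.ancestors S :=
  let ⟨s, hs, h'⟩ := hj
  ⟨s, hs, h'.head h⟩

theorem Linked.mem {G : ADMG V} {X Z S : Set V} (hX : X ⊆ S) {v : V}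
    (h : G.Linked X Z (G.ancestors S) v) : v ∈ G.ancestors S := by
  induction h with
  | start hx => exact G.subset_ancestors S (hX hx)
  | bi _ _ hj => exact hj
  | parent _ hd _ ih => exact mem_ancestors_of_dir hd ih
  | child _ _ _ hj => exact hj

/-- The disjunction in the conclusion keeps the walk extendable: a vertex of `Z` is passed only as a
collider. The delicate case is leaving by an arrowhead, treated in `key`. -/
theorem Linked.exists_reach {G : ADMG V} {X Y Z : Set V} (hsep : G.DSep X Y Z)
    (hXZ : Disjoint X Z) (hYZ : Disjoint Y Z) {v : V}
    (h : G.Linked X Z (G.ancestors (X ∪ Y ∪ Z)) v) :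
    ∃ e, G.Reach X Z v e ∧ (e.HeadAtEnd ∨ v ∉ Z) := by
  have key : ∀ {i j : V} {e f : Arrow}, G.Reach X Z i e → (e.HeadAtEnd ∨ i ∉ Z) →
      i ∈ G.ancestors (X ∪ Y ∪ Z) → G.HasArrow i f j → f.HeadAtStart → G.Reach X Z j f := by
    intro i j e f hr he hi hf hfs
    by_cases hz : ∃ z ∈ Z, G.IsAnc i z
    · by_cases heh : e.HeadAtEnd
      · exact hr.step hf (fun _ => hz) (fun h => absurd ⟨heh, hfs⟩ h)
      · exact hr.step hf (fun _ => hz) (fun _ => he.resolve_left heh)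
    -- A collider at `i` would be blocked here. But `i` is an ancestor of `X`, and can be entered
    -- afresh by a tail, or of `Y`, which the walk would then reach, or of `Z`, which is excluded.
    · have hiZ : i ∉ Z := fun h => hz ⟨i, h, Relation.ReflTransGen.refl⟩
      obtain ⟨s, (hs | hs) | hs, hs'⟩ := hi
      · exact (reach_left_of_isAnc hs hz hs').step hf (fun h => h.1.elim) (fun _ => hiZ)
      · obtain ⟨f', hf'⟩ := hr.exists_of_isAnc hz hs'
        exact absurd hf' (hsep.not_reach hs (Set.disjoint_left.1 hYZ hs))
      · exact absurd ⟨s, hs, hs'⟩ hz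
  induction h with
  | start hx => exact ⟨_, .start hx, Or.inr (Set.disjoint_left.1 hXZ hx)⟩
  | bi h hb hj ih =>
    obtain ⟨e, he, he'⟩ := ih
    exact ⟨.both, key he he' (h.mem (fun x hx => Or.inl (Or.inl hx))) hb trivial, Or.inl trivial⟩
  | parent h hd hj ih =>
    obtain ⟨e, he, he'⟩ := ih
    exact ⟨.left, key he he' (h.mem (fun x hx => Or.inl (Or.inl hx))) hd trivial, Or.inr hj⟩
  | child h hi hd hj ih =>
    obtain ⟨e, he, he'⟩ := ih
    exact ⟨.right, he.step hd (fun h => h.2.elim) (fun _ => hi), Or.inl trivial⟩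

theorem Linked.notMem {G : ADMG V} {X Y Z : Set V} (hsep : G.DSep X Y Z)
    (hXZ : Disjoint X Z) (hYZ : Disjoint Y Z) {v : V}
    (h : G.Linked X Z (G.ancestors (X ∪ Y ∪ Z)) v) : v ∉ Y := by
  intro hy
  obtain ⟨e, he, -⟩ := h.exists_reach hsep hXZ hYZ
  exact hsep.not_reach hy (Set.disjoint_left.1 hYZ hy) he

/-- The vertices of `S` together with their parents. -/
def withParents (G : ADMG V) (S : Set V) : Set V := {i | i ∈ S ∨ ∃ j ∈ S, G.dir i j}

/-- D-separation of `X` and `Y` by `Z` splits the ancestors of `X ∪ Y ∪ Z` into two parts without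
common bidirected arrows, which together with their parents overlap only in `Z`. -/
theorem DSep.exists_split {G : ADMG V} {X Y Z : Set V} (hsep : G.DSep X Y Z)
    (hXZ : Disjoint X Z) (hYZ : Disjoint Y Z) :
    ∃ S T : Set V, S ∪ T = G.ancestors (X ∪ Y ∪ Z) ∧ Disjoint S T ∧ (∀ i ∈ S, ∀ j ∈ T, ¬ G.bi i j) ∧
      G.withParents S ∩ G.withParents T ⊆ Z ∧ X ⊆ G.withParents S ∧
      Disjoint Y (G.withParents S) := by
  set A := G.ancestors (X ∪ Y ∪ Z) with hA
  have hmem : ∀ v, G.Linked X Z A v → v ∈ A := fun v hv => hv.mem fun x hx => Or.inl (Or.inl hx)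
  have hlink : ∀ v ∈ G.withParents {i | G.Linked X Z A i}, v ∉ Z → G.Linked X Z A v := by
    rintro v (hv | ⟨j, hj, hd⟩) hz
    · exact hv
    · exact .parent hj hd hz
  -- The parts are the linked vertices and the other ancestors. A variable outside `Z` occurring in
  -- equations of both would link the second equation too.
  refine ⟨{i | G.Linked X Z A i}, A \ {i | G.Linked X Z A i}, ?_, Set.disjoint_sdiff_right,
    fun i hi j hj hb => hj.2 (.bi hi hb hj.1), ?_, fun x hx => Or.inl (.start hx), ?_⟩
  · exact Set.union_sdiff_cancel hmem
  · rintro v ⟨h1, h2⟩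
    by_contra hz
    have h3 := hlink v h1 hz
    rcases h2 with h2 | ⟨j, hj, hd⟩
    · exact h2.2 h3
    · exact hj.2 (.child h3 hz hd hj.1)
  · rw [Set.disjoint_left]
    intro y hy h
    exact (hlink y h (Set.disjoint_left.1 hYZ hy)).notMem hsep hXZ hYZ hy

/-- If no element of `X` is an ancestor of `Z`, then separation of `Y` from `X` in the graph
without the arrows into `X` implies that no element of `X` is an ancestor of `Y`. -/
theorem not_isAnc_of_dSep_mutilate {G : ADMG V} {X Y Z W : Set V} (hXW : Disjoint X W)
    (hXY : Disjoint X Y) (hXWZ : Disjoint X (W ∪ Z))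
    (hZ : ∀ x ∈ X, ∀ z ∈ Z, ¬ (G.mutilate W ∅).IsAnc x z)
    (hsep : (G.mutilate (W ∪ X) ∅).DSep Y X (W ∪ Z)) {x y : V} (hx : x ∈ X) (hy : y ∈ Y) :
    ¬ (G.mutilate W ∅).IsAnc x y := by
  intro h
  -- The directed path is followed backwards from `y`. Its arrows survive the removal of those into
  -- `X` until a vertex of `X` is met, and that vertex violates the separation.
  have key : x ∉ W → (¬ ∃ z ∈ Z, (G.mutilate W ∅).IsAnc x z) →
      (∃ x' ∈ X, ∃ e, (G.mutilate (W ∪ X) ∅).Reach Y (W ∪ Z) x' e) ∨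
      (x ∉ X ∧ (G.mutilate (W ∪ X) ∅).Reach Y (W ∪ Z) x .left) := by
    clear hx
    induction h using Relation.ReflTransGen.head_induction_on with
    | refl => exact fun _ _ => Or.inr ⟨fun h => Set.disjoint_left.1 hXY h hy, .start hy⟩
    | @head a c hd hc ih =>
      intro ha haZ
      have hcZ : ¬ ∃ z ∈ Z, (G.mutilate W ∅).IsAnc c z :=
        fun ⟨z, hz, hz'⟩ => haZ ⟨z, hz, hz'.head hd⟩
      rcases ih hd.2.1 hcZ with h | ⟨h1, h2⟩
      · exact Or.inl h
      · have h3 : (G.mutilate (W ∪ X) ∅).Reach Y (W ∪ Z) a .left := by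
          refine h2.step (f := .left) ⟨hd.1, fun h => h.elim hd.2.1 h1, hd.2.2⟩
            (fun h => h.1.elim) fun _ h => h.elim hd.2.1 fun h => hcZ ⟨c, h, .refl⟩
        by_cases haX : a ∈ X
        · exact Or.inl ⟨a, haX, _, h3⟩
        · exact Or.inr ⟨haX, h3⟩
  rcases key (Set.disjoint_left.1 hXW hx) (fun ⟨z, hz, h'⟩ => hZ x hx z hz h') with
    ⟨x', hx', e, he⟩ | ⟨h1, -⟩
  · exact hsep.not_reach hx' (Set.disjoint_left.1 hXWZ hx') he
  · exact h1 hx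

theorem DSep.mutilate_tails {G : ADMG V} {X Y Z H : Set V} (h : (G.mutilate H ∅).DSep X Y Z)
    (T : Set V) : (G.mutilate H T).DSep X Y Z :=
  DSep.anti (G := G.mutilate H ∅) (H := G.mutilate H T)
    (fun _ _ hd => ⟨hd.1, hd.2.1, fun hf => hf⟩) (fun _ _ hb => hb) h

end ADMG

end Separation

end CausalId

namespace CausalId

/-! ### Conditional independence from a factorization. -/

section Markov

theorem measure_eq_tsum_inter_preimage {α β : Type*} [MeasurableSpace α] [MeasurableSpace β]
    [Countable β] [MeasurableSingletonClass β] (μ : Measure α) {f : α → β} (hf : Measurable f)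
    (T : Set α) : μ T = ∑' b, μ (T ∩ f ⁻¹' {b}) := by
  have h := tsum_measure_preimage_singleton (μ := μ.restrict T) (Set.countable_univ (α := β))
    (f := f) fun y _ => hf (measurableSet_singleton y)
  rw [Set.preimage_univ, Measure.restrict_apply_univ,
    tsum_univ fun b => μ.restrict T (f ⁻¹' {b})] at h
  rw [← h]
  exact tsum_congr fun b => by
    rw [Measure.restrict_apply (hf (measurableSet_singleton b)), Set.inter_comm]

variable {V : Type u} {Val : V → Type v}

/-- The joint values that agree with `a` on `S`. -/
def agree (S : Set V) (a : ∀ i, Val i) : Set (∀ i, Val i) := {ω | ∀ i ∈ S, ω i = a i}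

variable [Finite V] [∀ i, Countable (Val i)] [∀ i, MeasurableSpace (Val i)]
  [∀ i, MeasurableSingletonClass (Val i)]

/-- A distribution whose marginal on `A` is a product of two factors depending only on the variables
in `K` and `L`, where `K ∩ L ⊆ Z`, makes the variables in `X ⊆ K` and those in `Y`, disjoint from
`K`, conditionally independent given `Z`. -/
theorem measure_agree_mul_of_factorization (ν : Measure (∀ i, Val i)) {X Y Z A K L : Set V}
    (φ ψ : (∀ i, Val i) → ENNReal)
    (hν : ∀ v, ν (agree A v) = φ v * ψ v)
    (hφ : ∀ v v', (∀ i ∈ K, v i = v' i) → φ v = φ v')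
    (hψ : ∀ v v', (∀ i ∈ L, v i = v' i) → ψ v = ψ v')
    (hKL : K ∩ L ⊆ Z) (hXK : X ⊆ K) (hYK : Disjoint Y K) (hA : X ∪ Y ∪ Z ⊆ A) (a : ∀ i, Val i) :
    ν (agree (X ∪ Y ∪ Z) a) * ν (agree Z a) = ν (agree (X ∪ Z) a) * ν (agree (Y ∪ Z) a) := by
  classical
  -- Values outside `A` are filled in from `a`, so that `φ` and `ψ` can be evaluated at joint values
  -- of `A`.
  let ext : (∀ i : A, Val i) → ∀ i, Val i := fun u i => if h : i ∈ A then u ⟨i, h⟩ else a i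
  have hext : ∀ (u : ∀ i : A, Val i) (i) (h : i ∈ A), ext u i = u ⟨i, h⟩ := fun u i h => dif_pos h
  have hext' : ∀ (u : ∀ i : A, Val i) (i), i ∉ A → ext u i = a i := fun u i h => dif_neg h
  let wt : Set V → (∀ i : A, Val i) → ENNReal := fun S u =>
    if ∀ i ∈ S, ext u i = a i then φ (ext u) * ψ (ext u) else 0
  have hsum : ∀ S ⊆ A, ν (agree S a) = ∑' u, wt S u := by
    intro S hS
    rw [measure_eq_tsum_inter_preimage ν (f := fun (ω : ∀ i, Val i) (i : A) => ω i)
      (measurable_pi_lambda _ fun i => measurable_pi_apply _)]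
    refine tsum_congr fun u => ?_
    have hmem : ∀ ω : ∀ i, Val i, (fun i : A => ω i) = u ↔ ω ∈ agree A (ext u) := by
      intro ω
      constructor
      · intro h i hi
        rw [hext u i hi, ← h]
      · intro h
        funext i
        rw [h i i.2, hext u i i.2]
    by_cases h : ∀ i ∈ S, ext u i = a i
    · simp only [wt, if_pos h, ← hν]
      congr 1
      ext ω
      simp only [Set.mem_inter_iff, Set.mem_preimage, Set.mem_singleton_iff, hmem]
      exact ⟨fun h' => h'.2, fun h' => ⟨fun i hi => (h' i (hS hi)).trans (h i hi), h'⟩⟩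
    · simp only [wt, if_neg h]
      convert measure_empty (μ := ν)
      ext ω
      simp only [Set.mem_inter_iff, Set.mem_preimage, Set.mem_singleton_iff, hmem,
        Set.mem_empty_iff_false, iff_false, not_and]
      exact fun h1 h2 => h fun i hi => (h2 i (hS hi)).symm.trans (h1 i hi)
  have hprod : ∀ S T, S ⊆ A → T ⊆ A →
      ν (agree S a) * ν (agree T a) =
        ∑' p : (∀ i : A, Val i) × (∀ i : A, Val i), wt S p.1 * wt T p.2 := by
    intro S T hS hT
    rw [hsum S hS, hsum T hT, ENNReal.tsum_prod (f := fun u u' => wt S u * wt T u')]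
    simp_rw [ENNReal.tsum_mul_left, ENNReal.tsum_mul_right]
  -- Both products become sums over pairs of joint values. Exchanging the coordinates outside `K`
  -- between the two members maps one sum to the other term by term.
  let sw : (∀ i : A, Val i) × (∀ i : A, Val i) → (∀ i : A, Val i) × (∀ i : A, Val i) := fun p =>
    (fun i => if (i : V) ∈ K then p.1 i else p.2 i, fun i => if (i : V) ∈ K then p.2 i else p.1 i)
  have hsw : Function.Involutive sw := by
    intro p
    ext i <;> by_cases h : (i : V) ∈ K <;> simp [sw, h]
  have h1 : ∀ p (i), i ∈ K → ext (sw p).1 i = ext p.1 i ∧ ext (sw p).2 i = ext p.2 i := by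
    intro p i hi
    by_cases h : i ∈ A <;> simp [ext, h, sw, hi]
  have h2 : ∀ p (i), i ∉ K → ext (sw p).1 i = ext p.2 i ∧ ext (sw p).2 i = ext p.1 i := by
    intro p i hi
    by_cases h : i ∈ A <;> simp [ext, h, sw, hi]
  have hX : X ⊆ A := fun i hi => hA (Or.inl (Or.inl hi))
  have hY : Y ⊆ A := fun i hi => hA (Or.inl (Or.inr hi))
  have hZ : Z ⊆ A := fun i hi => hA (Or.inr hi)
  rw [hprod _ _ hA hZ, hprod _ _ (Set.union_subset hX hZ) (Set.union_subset hY hZ),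
    ← (hsw.toPerm).tsum_eq fun p => wt (X ∪ Z) p.1 * wt (Y ∪ Z) p.2]
  refine tsum_congr fun p => ?_
  change _ = wt (X ∪ Z) (sw p).1 * wt (Y ∪ Z) (sw p).2
  have hiff : ((∀ i ∈ X ∪ Y ∪ Z, ext p.1 i = a i) ∧ (∀ i ∈ Z, ext p.2 i = a i)) ↔
      ((∀ i ∈ X ∪ Z, ext (sw p).1 i = a i) ∧ (∀ i ∈ Y ∪ Z, ext (sw p).2 i = a i)) := by
    constructor
    · rintro ⟨h3, h4⟩
      refine ⟨fun i hi => ?_, fun i hi => ?_⟩ <;> by_cases hK : i ∈ K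
      · rw [(h1 p i hK).1]
        exact h3 i (hi.elim (fun h => Or.inl (Or.inl h)) Or.inr)
      · rw [(h2 p i hK).1]
        exact h4 i (hi.resolve_left fun h => hK (hXK h))
      · rw [(h1 p i hK).2]
        exact h4 i (hi.resolve_left fun h => Set.disjoint_left.1 hYK h hK)
      · rw [(h2 p i hK).2]
        exact h3 i (hi.elim (fun h => Or.inl (Or.inr h)) Or.inr)
    · rintro ⟨h3, h4⟩
      refine ⟨fun i hi => ?_, fun i hi => ?_⟩ <;> by_cases hK : i ∈ K
      · rw [← (h1 p i hK).1]
        refine h3 i (hi.elim (fun h => Or.inl (h.resolve_right fun h => ?_)) Or.inr)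
        exact Set.disjoint_left.1 hYK h hK
      · rw [← (h2 p i hK).2]
        exact h4 i (hi.elim (fun h => Or.inl (h.resolve_left fun h => hK (hXK h))) Or.inr)
      · rw [← (h1 p i hK).2]
        exact h4 i (Or.inr hi)
      · rw [← (h2 p i hK).1]
        exact h3 i (Or.inr hi)
  by_cases hc : (∀ i ∈ X ∪ Y ∪ Z, ext p.1 i = a i) ∧ (∀ i ∈ Z, ext p.2 i = a i)
  · have hc' := hiff.1 hc
    simp only [wt, if_pos hc.1, if_pos hc.2, if_pos hc'.1, if_pos hc'.2]
    -- On `K ∩ L ⊆ Z` both members agree with `a`, so for `ψ` the exchange amounts to swapping the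
    -- two members entirely.
    have hz : ∀ i ∈ K ∩ L, ext p.1 i = ext p.2 i := fun i hi =>
      (hc.1 i (Or.inr (hKL hi))).trans (hc.2 i (hKL hi)).symm
    rw [hφ (ext (sw p).1) (ext p.1) fun i hi => (h1 p i hi).1,
      hφ (ext (sw p).2) (ext p.2) fun i hi => (h1 p i hi).2,
      hψ (ext (sw p).1) (ext p.2) fun i hi => ?_, hψ (ext (sw p).2) (ext p.1) fun i hi => ?_]
    · ring
    · by_cases hK : i ∈ K
      · rw [(h1 p i hK).2, hz i ⟨hK, hi⟩]
      · exact (h2 p i hK).2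
    · by_cases hK : i ∈ K
      · rw [(h1 p i hK).1, hz i ⟨hK, hi⟩]
      · exact (h2 p i hK).1
  · have hc' := fun h => hc (hiff.2 h)
    have e1 : wt (X ∪ Y ∪ Z) p.1 * wt Z p.2 = 0 := by
      rcases not_and_or.1 hc with h | h
      · simp only [wt, if_neg h, zero_mul]
      · simp only [wt, if_neg h, mul_zero]
    have e2 : wt (X ∪ Z) (sw p).1 * wt (Y ∪ Z) (sw p).2 = 0 := by
      rcases not_and_or.1 hc' with h | h
      · simp only [wt, if_neg h, zero_mul]
      · simp only [wt, if_neg h, mul_zero]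
    rw [e1, e2]

end Markov

/-! ### Structural equations and the global Markov property of a model. -/

namespace SCM

variable {V : Type u} {Val : V → Type v} [∀ i, MeasurableSpace (Val i)]

/-- The exogenous values for which the structural equation of `i` holds at the joint value `v`. -/
def eqnEvent (M : SCM.{u, v, w} V Val) (i : V) (v : ∀ i, Val i) : Set (∀ j, M.ExoVal j) :=
  {e | M.fn i (fun j => e j) (fun k => v k) = v i}

/-- The exogenous values for which the structural equations of all `i ∈ S` hold at the joint
value `v`. -/
def eqnsEvent (M : SCM.{u, v, w} V Val) (S : Set V) (v : ∀ i, Val i) : Set (∀ j, M.ExoVal j) :=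
  {e | ∀ i ∈ S, e ∈ M.eqnEvent i v}

theorem eqnsEvent_congr (M : SCM.{u, v, w} V Val) (S : Set V) {v v' : ∀ i, Val i}
    (h : ∀ i ∈ M.graph.withParents S, v i = v' i) : M.eqnsEvent S v = M.eqnsEvent S v' := by
  ext e
  refine forall₂_congr fun i hi => ?_
  have h1 : (fun k : M.pa i => v k) = fun k : M.pa i => v' k :=
    funext fun k => h k (Or.inr ⟨i, hi, k.2⟩)
  simp only [eqnEvent, Set.mem_ofPred_eq, h1, h i (Or.inl hi)]

theorem eqnsEvent_union (M : SCM.{u, v, w} V Val) (S T : Set V) (v : ∀ i, Val i) :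
    M.eqnsEvent (S ∪ T) v = M.eqnsEvent S v ∩ M.eqnsEvent T v := by
  ext e
  exact ⟨fun h => ⟨fun i hi => h i (Or.inl hi), fun i hi => h i (Or.inr hi)⟩,
    fun h i hi => hi.elim (h.1 i) (h.2 i)⟩

section Independence

variable [Finite V] [∀ i, MeasurableSingletonClass (Val i)]

theorem measurableSet_eqnsEvent (M : SCM.{u, v, w} V Val) (S : Set V) (v : ∀ i, Val i) :
    MeasurableSet[⨆ j ∈ ⋃ i ∈ S, M.exo i, (M.mExo j).comap fun e : ∀ j, M.ExoVal j => e j]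
      (M.eqnsEvent S v) := by
  have : M.eqnsEvent S v = ⋂ i ∈ S, M.eqnEvent i v := by
    ext e
    simp [eqnsEvent]
  rw [this]
  refine MeasurableSet.biInter S.to_countable fun i hi => ?_
  have hm : Measurable[⨆ j ∈ ⋃ i ∈ S, M.exo i, (M.mExo j).comap fun e : ∀ j, M.ExoVal j => e j]
      fun (e : ∀ j, M.ExoVal j) (j : M.exo i) => e j := by
    refine @measurable_pi_lambda _ _ _ (_) _ _ fun j => ?_
    refine Measurable.mono (comap_measurable fun e : ∀ j, M.ExoVal j => e j) ?_ le_rfl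
    exact le_iSup₂_of_le (j : M.Exo) (Set.mem_biUnion hi j.2) le_rfl
  exact (M.fn_meas i fun k => v k).comp hm (measurableSet_singleton (v i))

/-- Without bidirected arrows between the disjoint sets, their equations use disjoint families of
exogenous variables and are independent. -/
theorem measure_eqnsEvent_union (M : SCM.{u, v, w} V Val) {S T : Set V} (hST : Disjoint S T)
    (hbi : ∀ i ∈ S, ∀ j ∈ T, ¬ M.graph.bi i j) (v : ∀ i, Val i) :
    Measure.infinitePi M.law (M.eqnsEvent (S ∪ T) v) =
      Measure.infinitePi M.law (M.eqnsEvent S v) * Measure.infinitePi M.law (M.eqnsEvent T v) := by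
  have hind := (ProbabilityTheory.iIndepFun_infinitePi (P := M.law)
    (X := fun j (x : M.ExoVal j) => x)
    fun j => measurable_id).iIndep
  have hdisj : Disjoint (⋃ i ∈ S, M.exo i) (⋃ i ∈ T, M.exo i) := by
    simp only [Set.disjoint_iUnion_left, Set.disjoint_iUnion_right]
    intro i hi j hj
    rw [Set.disjoint_iff_inter_eq_empty, ← Set.not_nonempty_iff_eq_empty]
    exact fun h => hbi j hj i hi ⟨fun h' => Set.disjoint_left.1 hST hj (h' ▸ hi), h⟩
  have := ProbabilityTheory.indep_iSup_of_disjoint (fun j => (measurable_pi_apply j).comap_le) hind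
    hdisj
  rw [eqnsEvent_union]
  exact (ProbabilityTheory.Indep_iff _ _ _).1 this _ _ (M.measurableSet_eqnsEvent S v)
    (M.measurableSet_eqnsEvent T v)

end Independence

variable [Finite V] [DecidableEq V]

theorem solve_eq_of_notMem (M : SCM.{u, v, w} V Val) {B : Finset V} (b : ∀ i : B, Val i)
    (e : ∀ j, M.ExoVal j) {i : V} (hi : i ∉ B) :
    M.solve B b e i = M.fn i (fun j => e j) (fun k => M.solve B b e k) := by
  rw [solve_eq, dif_neg hi]

theorem solve_eq_of_mem (M : SCM.{u, v, w} V Val) {B : Finset V} (b : ∀ i : B, Val i)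
    (e : ∀ j, M.ExoVal j) {i : V} (hi : i ∈ B) : M.solve B b e i = b ⟨i, hi⟩ := by
  rw [solve_eq, dif_pos hi]

/-- Acyclicity makes the solution unique. Solutions of different models are compared below by
checking equations only. -/
theorem eq_solve (M : SCM.{u, v, w} V Val) {B : Finset V} {b : ∀ i : B, Val i}
    {e : ∀ j, M.ExoVal j} {v : ∀ i, Val i} (hB : ∀ i (hi : i ∈ B), v i = b ⟨i, hi⟩)
    (h : ∀ i, i ∉ B → v i = M.fn i (fun j => e j) (fun k => v k)) : v = M.solve B b e := by
  funext i
  induction i using M.wf.induction with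
  | _ i ih =>
    by_cases hi : i ∈ B
    · rw [hB i hi, solve_eq_of_mem _ _ _ hi]
    · rw [h i hi, solve_eq_of_notMem _ _ _ hi]
      congr 1
      funext k
      exact ih k k.2

/-- The observational values of the endogenous variables, as a function of the exogenous ones. -/
noncomputable def sol (M : SCM.{u, v, w} V Val) (e : ∀ j, M.ExoVal j) : ∀ i, Val i :=
  M.solve ∅ (fun i => absurd i.2 (Finset.notMem_empty _)) e

theorem sol_eq (M : SCM.{u, v, w} V Val) (e : ∀ j, M.ExoVal j) (i : V) :
    M.sol e i = M.fn i (fun j => e j) (fun k => M.sol e k) :=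
  solve_eq_of_notMem _ _ _ (Finset.notMem_empty _)

theorem eq_sol (M : SCM.{u, v, w} V Val) {e : ∀ j, M.ExoVal j} {v : ∀ i, Val i}
    (h : ∀ i, v i = M.fn i (fun j => e j) (fun k => v k)) : v = M.sol e :=
  M.eq_solve (fun _ hi => absurd hi (Finset.notMem_empty _)) fun i _ => h i

/-- Equations of an ancestrally closed set involve only its own variables. The marginal on such a
set is therefore the probability of an event about equations, which factorizes. -/
theorem sol_mem_agree_iff (M : SCM.{u, v, w} V Val) {S : Set V}
    (hS : ∀ i j, M.graph.dir i j → j ∈ S → i ∈ S) (v : ∀ i, Val i) (e : ∀ j, M.ExoVal j) :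
    M.sol e ∈ agree S v ↔ e ∈ M.eqnsEvent S v := by
  constructor
  · intro h i hi
    have h1 : (fun k : M.pa i => v k) = fun k : M.pa i => M.sol e k :=
      funext fun k => (h k (hS k i k.2 hi)).symm
    change M.fn i _ _ = _
    rw [h1, ← sol_eq]
    exact h i hi
  · intro h i
    induction i using M.wf.induction with
    | _ i ih =>
      intro hi
      have h1 : (fun k : M.pa i => M.sol e k) = fun k : M.pa i => v k :=
        funext fun k => ih k k.2 (hS k i k.2 hi)
      rw [sol_eq, h1]
      exact h i hi

variable [∀ i, Countable (Val i)] [∀ i, MeasurableSingletonClass (Val i)]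

theorem obs_apply (M : SCM.{u, v, w} V Val) (S : Set (∀ i, Val i)) :
    (M.obs : Measure (∀ i, Val i)) S = Measure.infinitePi M.law (M.sol ⁻¹' S) :=
  Measure.map_apply (M.measurable_solve _ _) (MeasurableSet.of_discrete)

/-- The global Markov property of the observational distribution. -/
theorem obs_agree_mul (M : SCM.{u, v, w} V Val) {X Y Z : Set V} (hsep : M.graph.DSep X Y Z)
    (hXZ : Disjoint X Z) (hYZ : Disjoint Y Z) (a : ∀ i, Val i) :
    (M.obs : Measure (∀ i, Val i)) (agree (X ∪ Y ∪ Z) a) * (M.obs : Measure _) (agree Z a) =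
      (M.obs : Measure _) (agree (X ∪ Z) a) * (M.obs : Measure _) (agree (Y ∪ Z) a) := by
  obtain ⟨S, T, hST, hdisj, hbi, hKL, hX, hY⟩ := hsep.exists_split hXZ hYZ
  refine measure_agree_mul_of_factorization (A := S ∪ T) (K := M.graph.withParents S)
    (L := M.graph.withParents T) M.obs
    (fun v => Measure.infinitePi M.law (M.eqnsEvent S v))
    (fun v => Measure.infinitePi M.law (M.eqnsEvent T v)) (fun v => ?_)
    (fun v v' h => by rw [M.eqnsEvent_congr S h]) (fun v v' h => by rw [M.eqnsEvent_congr T h])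
    hKL hX hY (hST ▸ M.graph.subset_ancestors _) a
  rw [← M.measure_eqnsEvent_union hdisj hbi, obs_apply]
  congr 1
  ext e
  exact M.sol_mem_agree_iff (fun i j hd hj => by
    rw [hST] at hj ⊢; exact ADMG.mem_ancestors_of_dir hd hj) v e

end SCM

end CausalId

namespace CausalId

/-! ### Single-world intervention models and the rules in product form. -/

namespace SCM

variable {V : Type u} {Val : V → Type v} [∀ i, MeasurableSpace (Val i)]

open Classical in
/-- The single-world intervention model: the variables in `W` are set to the values given by `a`,
and the values given by `a` are substituted for the variables in `X` in all equations in which the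
latter occur as parents. -/
noncomputable def swig (M : SCM.{u, v, w} V Val) (W X : Finset V) (a : ∀ i, Val i) :
    SCM.{u, v, w} V Val where
  Exo := M.Exo
  ExoVal := M.ExoVal
  mExo := M.mExo
  law := M.law
  law_prob := M.law_prob
  exo i := {j | j ∈ M.exo i ∧ i ∉ W}
  pa i := (M.pa i).filter fun k => i ∉ W ∧ k ∉ X
  fn i e p := if hi : i ∈ W then a i else
    M.fn i (fun j => e ⟨j, j.2, hi⟩) fun k =>
      if hk : (k : V) ∈ X then a k else p ⟨k, Finset.mem_filter.2 ⟨k.2, hi, hk⟩⟩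
  fn_meas i p := by
    by_cases hi : i ∈ W
    · simp only [hi, dite_true]
      exact measurable_const
    · simp only [hi, dite_false]
      exact (M.fn_meas i _).comp (measurable_pi_lambda _ fun j => measurable_pi_apply _)
  acyclic i h := M.acyclic i (Relation.TransGen.mono (fun _ _ h => (Finset.mem_filter.1 h).1) _ _ h)

/-- This makes the Markov property available for d-separations in mutilated graphs. -/
theorem graph_swig (M : SCM.{u, v, w} V Val) (W X : Finset V) (a : ∀ i, Val i) :
    (M.swig W X a).graph = M.graph.mutilate W X := by
  ext i j
  · exact @Finset.mem_filter _ _ (_) _ _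
  · constructor
    · rintro ⟨h, k, hk⟩
      exact ⟨⟨h, k, hk.1.1, hk.2.1⟩, hk.1.2, hk.2.2⟩
    · rintro ⟨⟨h, k, hk⟩, hi, hj⟩
      exact ⟨h, k, ⟨hk.1, hi⟩, hk.2, hj⟩

variable [DecidableEq V]

theorem swig_fn (M : SCM.{u, v, w} V Val) (W X : Finset V) (a : ∀ i, Val i)
    (e : ∀ j, M.ExoVal j) (v : ∀ i, Val i) (i : V) :
    (M.swig W X a).fn i (fun j => e j.1) (fun k => v k) =
      if i ∈ W then a i else M.fn i (fun j => e j) (fun k => if (k : V) ∈ X then a k else v k) := by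
  by_cases hi : i ∈ W
  · rw [if_pos hi]
    exact dif_pos hi
  · rw [if_neg hi]
    refine (dif_neg hi).trans (congrArg (M.fn i _) (funext fun k => ?_))
    by_cases hk : (k : V) ∈ X <;> simp [hk]

variable [Finite V]

/-- The values of the endogenous variables under the intervention setting the variables in `B` to
the values given by `a`. -/
noncomputable def doSol (M : SCM.{u, v, w} V Val) (B : Finset V) (a : ∀ i, Val i)
    (e : ∀ j, M.ExoVal j) : ∀ i, Val i :=
  M.solve B (fun i => a i) e

theorem doSol_of_mem (M : SCM.{u, v, w} V Val) {B : Finset V} (a : ∀ i, Val i)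
    (e : ∀ j, M.ExoVal j) {i : V} (hi : i ∈ B) : M.doSol B a e i = a i :=
  M.solve_eq_of_mem _ _ hi

theorem doSol_of_notMem (M : SCM.{u, v, w} V Val) {B : Finset V} (a : ∀ i, Val i)
    (e : ∀ j, M.ExoVal j) {i : V} (hi : i ∉ B) :
    M.doSol B a e i = M.fn i (fun j => e j) (fun k => M.doSol B a e k) :=
  M.solve_eq_of_notMem _ _ hi

/-- The values of the endogenous variables in the single-world intervention model. -/
noncomputable def swigSol (M : SCM.{u, v, w} V Val) (W X : Finset V) (a : ∀ i, Val i)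
    (e : ∀ j, M.ExoVal j) : ∀ i, Val i :=
  (M.swig W X a).sol e

theorem swigSol_of_mem (M : SCM.{u, v, w} V Val) {W X : Finset V} (a : ∀ i, Val i)
    (e : ∀ j, M.ExoVal j) {i : V} (hi : i ∈ W) : M.swigSol W X a e i = a i :=
  ((M.swig W X a).sol_eq e i).trans ((M.swig_fn W X a e (M.swigSol W X a e) i).trans (if_pos hi))

theorem swigSol_of_notMem (M : SCM.{u, v, w} V Val) {W X : Finset V} (a : ∀ i, Val i)
    (e : ∀ j, M.ExoVal j) {i : V} (hi : i ∉ W) : M.swigSol W X a e i =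
      M.fn i (fun j => e j) (fun k => if (k : V) ∈ X then a k else M.swigSol W X a e k) :=
  ((M.swig W X a).sol_eq e i).trans ((M.swig_fn W X a e (M.swigSol W X a e) i).trans (if_neg hi))

theorem eq_swigSol (M : SCM.{u, v, w} V Val) {W X : Finset V} {a : ∀ i, Val i}
    {e : ∀ j, M.ExoVal j} {v : ∀ i, Val i} (h : ∀ i, v i = if i ∈ W then a i else
      M.fn i (fun j => e j) (fun k => if (k : V) ∈ X then a k else v k)) :
    v = M.swigSol W X a e :=
  (M.swig W X a).eq_sol fun i => (h i).trans (M.swig_fn W X a e v i).symm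

/-- Other equations see only the substituted values of `X`, so what `X` itself does is irrelevant to
them. -/
theorem swigSol_eq_doSol_union (M : SCM.{u, v, w} V Val) {W X : Finset V} (a : ∀ i, Val i)
    (e : ∀ j, M.ExoVal j) {i : V} (hi : i ∉ X) :
    M.swigSol W X a e i = M.doSol (W ∪ X) a e i := by
  have : (fun k => if k ∈ X then a k else M.swigSol W X a e k) = M.doSol (W ∪ X) a e := by
    refine M.eq_solve (fun k hk => ?_) fun k hk => ?_
    · by_cases hX : k ∈ X
      · simp [hX]
      · rw [if_neg hX]
        exact M.swigSol_of_mem a e ((Finset.mem_union.1 hk).resolve_right hX)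
    · rw [Finset.mem_union, not_or] at hk
      rw [if_neg hk.2]
      exact M.swigSol_of_notMem a e hk.1
  rw [← this]
  exact (if_neg hi).symm

/-- Consistency: once `X` takes the values of `a`, substituting them changes no equation, so the two
solutions coincide. -/
theorem swigSol_mem_agree_iff (M : SCM.{u, v, w} V Val) {W X : Finset V} (a : ∀ i, Val i)
    (e : ∀ j, M.ExoVal j) {S : Set V} (hS : (X : Set V) ⊆ S) :
    M.swigSol W X a e ∈ agree S a ↔ M.doSol W a e ∈ agree S a := by
  have key : ∀ v ∈ agree S a, (fun k => if k ∈ X then a k else v k) = v := by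
    intro v hv
    funext k
    split_ifs with hX
    · exact (hv k (hS hX)).symm
    · rfl
  constructor
  · intro h
    suffices M.swigSol W X a e = M.doSol W a e from this ▸ h
    refine M.eq_solve (fun k hk => M.swigSol_of_mem a e hk) fun k hk => ?_
    rw [swigSol_of_notMem _ _ _ hk]
    exact congrArg (M.fn k _) (funext fun l => congrFun (key _ h) l)
  · intro h
    suffices M.doSol W a e = M.swigSol W X a e from this ▸ h
    refine M.eq_swigSol fun i => ?_
    split_ifs with hi
    · exact doSol_of_mem _ _ _ hi
    · rw [doSol_of_notMem _ _ _ hi]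
      exact congrArg (M.fn i _) (funext fun l => (congrFun (key _ h) l).symm)

theorem doSol_union_eq (M : SCM.{u, v, w} V Val) {W X : Finset V} (a : ∀ i, Val i)
    (e : ∀ j, M.ExoVal j) {i : V} (hi : ∀ x ∈ X, ¬ (M.graph.mutilate W ∅).IsAnc x i) :
    M.doSol (W ∪ X) a e i = M.doSol W a e i := by
  induction i using M.wf.induction with
  | _ i ih =>
    have hX : i ∉ X := fun h => hi i h .refl
    by_cases hW : i ∈ W
    · rw [doSol_of_mem _ _ _ hW, doSol_of_mem _ _ _ (Finset.mem_union_left _ hW)]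
    · rw [doSol_of_notMem _ _ _ hW, doSol_of_notMem _ _ _ (by simp [hW, hX])]
      congr 1
      funext k
      refine ih k k.2 fun x hx h => hi x hx (h.tail ⟨k.2, hW, fun h => h⟩)

variable [∀ i, Countable (Val i)] [∀ i, MeasurableSingletonClass (Val i)]

/-- The probability under `do(B = a)` that the variables in `S` take the values given by `a`. -/
noncomputable def doProb (M : SCM.{u, v, w} V Val) (B : Finset V) (S : Set V) (a : ∀ i, Val i) :
    ENNReal :=
  (M.interv B (fun i => a i) : Measure (∀ i, Val i)) (agree S a)

theorem doProb_eq (M : SCM.{u, v, w} V Val) (B : Finset V) (S : Set V) (a : ∀ i, Val i) :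
    M.doProb B S a = Measure.infinitePi M.law (M.doSol B a ⁻¹' agree S a) :=
  Measure.map_apply (M.measurable_solve _ _) MeasurableSet.of_discrete

/-- Under `do(B = a)` the variables in `B` have the values of `a` anyway, so prescribing them is
vacuous. This removes `W` from the conditioning sets. -/
theorem doProb_congr (M : SCM.{u, v, w} V Val) {B : Finset V} {S T : Set V}
    (h : ∀ i, i ∉ B → (i ∈ S ↔ i ∈ T)) (a : ∀ i, Val i) : M.doProb B S a = M.doProb B T a := by
  rw [doProb_eq, doProb_eq]
  congr 1
  ext e
  refine forall_congr' fun i => ?_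
  by_cases hi : i ∈ B
  · simp [M.doSol_of_mem a e hi]
  · rw [h i hi]

theorem doProb_union (M : SCM.{u, v, w} V Val) {B : Finset V} {W S : Set V} (hW : W ⊆ B)
    (a : ∀ i, Val i) : M.doProb B (W ∪ S) a = M.doProb B S a :=
  M.doProb_congr (fun _ hi => or_iff_right fun h => hi (hW h)) a

theorem doProb_union_union (M : SCM.{u, v, w} V Val) {B : Finset V} {W : Set V} (hW : W ⊆ B)
    (S T : Set V) (a : ∀ i, Val i) : M.doProb B (S ∪ (W ∪ T)) a = M.doProb B (S ∪ T) a := by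
  rw [Set.union_left_comm, M.doProb_union hW]

theorem swig_obs_agree_of_subset (M : SCM.{u, v, w} V Val) {W X : Finset V} {S : Set V}
    (hS : (X : Set V) ⊆ S) (a : ∀ i, Val i) :
    ((M.swig W X a).obs : Measure (∀ i, Val i)) (agree S a) = M.doProb W S a := by
  rw [obs_apply, doProb_eq]
  exact congrArg (Measure.infinitePi M.law) (Set.ext fun e => M.swigSol_mem_agree_iff a e hS)

theorem swig_obs_agree_of_disjoint (M : SCM.{u, v, w} V Val) {W X : Finset V} {S : Set V}
    (hS : Disjoint (X : Set V) S) (a : ∀ i, Val i) :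
    ((M.swig W X a).obs : Measure (∀ i, Val i)) (agree S a) = M.doProb (W ∪ X) S a := by
  rw [obs_apply, doProb_eq]
  refine congrArg (Measure.infinitePi M.law) (Set.ext fun e => forall₂_congr fun i hi => ?_)
  have := M.swigSol_eq_doSol_union (W := W) a e (i := i) fun h => Set.disjoint_left.1 hS h hi
  exact Eq.congr_left this

/-- R1 with denominators cleared. -/
theorem doProb_mul_of_dSep (M : SCM.{u, v, w} V Val) {B : Finset V} {X Y W Z : Set V} (hW : W ⊆ B)
    (hX : Disjoint X (W ∪ Z)) (hY : Disjoint Y (W ∪ Z))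
    (hsep : (M.graph.mutilate B ∅).DSep Y X (W ∪ Z)) (a : ∀ i, Val i) :
    M.doProb B (Y ∪ X ∪ Z) a * M.doProb B Z a = M.doProb B (Y ∪ Z) a * M.doProb B (X ∪ Z) a := by
  have h := (M.swig B ∅ a).obs_agree_mul (by rw [graph_swig, Finset.coe_empty]; exact hsep) hY hX a
  simp only [M.swig_obs_agree_of_subset (X := ∅) (by simp)] at h
  simp only [M.doProb_union_union hW] at h
  rwa [M.doProb_union hW] at h

/-- R2 with denominators cleared. In the Markov identity of the `swig`, factors mentioning `X` are
read under `do(B)`, the others under `do(B ∪ X)`. -/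
theorem doProb_mul_of_dSep_tails (M : SCM.{u, v, w} V Val) {B X : Finset V} {Y W Z : Set V}
    (hW : W ⊆ B) (hXY : Disjoint (X : Set V) Y) (hX : Disjoint (X : Set V) (W ∪ Z))
    (hY : Disjoint Y (W ∪ Z))
    (hsep : (M.graph.mutilate B X).DSep Y X (W ∪ Z)) (a : ∀ i, Val i) :
    M.doProb B (Y ∪ X ∪ Z) a * M.doProb (B ∪ X) Z a =
      M.doProb (B ∪ X) (Y ∪ Z) a * M.doProb B (X ∪ Z) a := by
  have h := (M.swig B X a).obs_agree_mul (by rw [graph_swig]; exact hsep) hY hX a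
  have hW' : W ⊆ ((B ∪ X : Finset V) : Set V) := fun i hi => by simp [hW hi]
  rw [M.swig_obs_agree_of_subset (Set.subset_union_right.trans Set.subset_union_left),
    M.swig_obs_agree_of_disjoint hX,
    M.swig_obs_agree_of_disjoint (Set.disjoint_union_right.2 ⟨hXY, hX⟩),
    M.swig_obs_agree_of_subset Set.subset_union_left] at h
  rwa [M.doProb_union_union hW, M.doProb_union_union hW, M.doProb_union_union hW',
    M.doProb_union hW'] at h

theorem doProb_union_eq (M : SCM.{u, v, w} V Val) {W X : Finset V} {S : Set V}
    (hS : ∀ x ∈ X, ∀ s ∈ S, ¬ (M.graph.mutilate W ∅).IsAnc x s) (a : ∀ i, Val i) :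
    M.doProb (W ∪ X) S a = M.doProb W S a := by
  rw [doProb_eq, doProb_eq]
  refine congrArg _ (Set.ext fun e => forall₂_congr fun i hi => ?_)
  rw [M.doSol_union_eq a e fun x hx => hS x hx i hi]

theorem doProb_ne_top (M : SCM.{u, v, w} V Val) (B : Finset V) (S : Set V) (a : ∀ i, Val i) :
    M.doProb B S a ≠ ⊤ :=
  measure_ne_top _ _

/-- Exogenous values that produce `a` observationally still produce it under an intervention
consistent with `a`. -/
theorem interv_singleton_pos (M : SCM.{u, v, w} V Val) (hM : M.Positive) {B : Finset V}
    {b : ∀ i : B, Val i} {a : ∀ i, Val i} (h : ∀ i : B, a i = b i) :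
    0 < (M.interv B b : Measure (∀ i, Val i)) {a} := by
  refine (hM a).trans_le ?_
  rw [obs_apply]
  refine le_of_le_of_eq (measure_mono fun e (he : M.sol e = a) => ?_)
    (Measure.map_apply (M.measurable_solve B b) (measurableSet_singleton a)).symm
  refine Eq.symm (M.eq_solve (fun i hi => h ⟨i, hi⟩) fun i _ => ?_)
  rw [← he]
  exact M.sol_eq e i

theorem doProb_ne_zero (M : SCM.{u, v, w} V Val) (hM : M.Positive) (B : Finset V) (S : Set V)
    (a : ∀ i, Val i) : M.doProb B S a ≠ 0 := by
  have h1 := M.interv_singleton_pos hM (B := B) (b := fun i => a i) (a := a) fun _ => rfl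
  refine (h1.trans_le (measure_mono ?_)).ne'
  rintro _ rfl i _
  rfl

/-- The interventional distributions of a positive model. -/
noncomputable def family (M : SCM.{u, v, w} V Val) (hM : M.Positive) : IntervFamily V Val where
  dist := M.interv
  pos_iff B b a := by
    refine ⟨fun h i => ?_, M.interv_singleton_pos hM⟩
    by_contra hne
    refine h.ne' ((Measure.map_apply (M.measurable_solve B b) (measurableSet_singleton a)).trans ?_)
    convert measure_empty (μ := Measure.infinitePi M.law)
    ext e
    simp only [Set.mem_preimage, Set.mem_singleton_iff, Set.mem_empty_iff_false, iff_false]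
    rintro rfl
    exact hne (M.solve_eq_of_mem b e i.2)

theorem cond_interv (M : SCM.{u, v, w} V Val) (A B C : Finset V) (a : ∀ i, Val i) :
    (ProbabilityTheory.cond (M.interv B fun i => a i : Measure (∀ i, Val i)) (cyl C a)).real
      (cyl A a) = (M.doProb B (A ∪ C) a / M.doProb B C a).toReal := by
  rw [Measure.real, ProbabilityTheory.cond_apply MeasurableSet.of_discrete, div_eq_mul_inv,
    mul_comm]
  congr 3
  ext ω
  exact ⟨fun h i hi => hi.elim (h.2 i) (h.1 i), fun h => ⟨fun i hi => h i (Or.inr hi),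
    fun i hi => h i (Or.inl hi)⟩⟩

theorem doProb_div_eq (M : SCM.{u, v, w} V Val) (hM : M.Positive) {B B' : Finset V}
    {S T S' T' : Set V} {a : ∀ i, Val i}
    (h : M.doProb B S a * M.doProb B' T' a = M.doProb B' S' a * M.doProb B T a) :
    M.doProb B S a / M.doProb B T a = M.doProb B' S' a / M.doProb B' T' a :=
  (ENNReal.div_eq_div_iff (M.doProb_ne_zero hM _ _ _) (M.doProb_ne_top _ _ _)
    (M.doProb_ne_zero hM _ _ _) (M.doProb_ne_top _ _ _)).2 (by rw [mul_comm, h, mul_comm])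

end SCM

end CausalId

namespace CausalId

/-! ### Soundness of do-calculus, and estimands from criteria. -/

section Soundness

variable {V : Type u} [Finite V] [DecidableEq V] {Val : V → Type v} [∀ i, Countable (Val i)]
  [∀ i, MeasurableSpace (Val i)] [∀ i, MeasurableSingletonClass (Val i)]

namespace SCM

theorem eval_prob_family (M : SCM.{u, v, w} V Val) (hM : M.Positive) (A B C : Finset V)
    (a : ∀ i, Val i) : (Expr.prob A B C a).eval (M.family hM) =
      (M.doProb B (A ∪ C) a / M.doProb B C a).toReal :=
  M.cond_interv A B C a

theorem eval_expr_family (M : SCM.{u, v, w} V Val) (hM : M.Positive) (Q : CausalQuery V Val) :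
    Q.expr.eval (M.family hM) = M.condProb Q.Y Q.X Q.Z Q.val :=
  rfl

/-- R3 with denominators cleared. With `X₁` the non-ancestors of `Z` in `X`, R2 under `do(W ∪ X₁)`
turns the intervention on `X \ X₁` into an observation, R1 deletes it, and `do(X₁)` is dropped
because `X₁` has no descendant in `Y ∪ Z`. -/
theorem doProb_mul_of_dSep_heads (M : SCM.{u, v, w} V Val) (hM : M.Positive) {X Y Z W : Finset V}
    (hXY : Disjoint X Y) (hXW : Disjoint X W) (hXZ : Disjoint X Z) (hYZ : Disjoint Y Z)
    (hYW : Disjoint Y W)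
    (hsep : (M.graph.mutilate (W ∪ {x | x ∈ X ∧ ∀ z ∈ Z, ¬ (M.graph.mutilate W ∅).IsAnc x z})
      ∅).DSep Y X (W ∪ Z)) (a : ∀ i, Val i) :
    M.doProb (W ∪ X) (Y ∪ Z) a * M.doProb W Z a =
      M.doProb W (Y ∪ Z) a * M.doProb (W ∪ X) Z a := by
  classical
  set X₁ := X.filter fun x => ∀ z ∈ Z, ¬ (M.graph.mutilate W ∅).IsAnc x z with hX₁
  have hcoe : ((W : Set V) ∪ {x | x ∈ X ∧ ∀ z ∈ Z, ¬ (M.graph.mutilate W ∅).IsAnc x z}) =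
      (W : Set V) ∪ X₁ := by
    ext; simp [hX₁]
  rw [hcoe] at hsep
  have h1 : X₁ ⊆ X := Finset.filter_subset _ _
  have dXY : Disjoint (X : Set V) Y := by exact_mod_cast hXY
  have dXWZ : Disjoint (X : Set V) (W ∪ Z) :=
    Set.disjoint_union_right.2 ⟨by exact_mod_cast hXW, by exact_mod_cast hXZ⟩
  have dYWZ : Disjoint (Y : Set V) (W ∪ Z) :=
    Set.disjoint_union_right.2 ⟨by exact_mod_cast hYW, by exact_mod_cast hYZ⟩
  have h1' : (X₁ : Set V) ⊆ X := by exact_mod_cast h1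
  have h2 : ((X \ X₁ : Finset V) : Set V) ⊆ X := by exact_mod_cast Finset.sdiff_subset
  have hZ : ∀ x ∈ (X₁ : Set V), ∀ z ∈ (Z : Set V), ¬ (M.graph.mutilate W ∅).IsAnc x z :=
    fun x hx => (Finset.mem_filter.1 hx).2
  have hY : ∀ x ∈ (X₁ : Set V), ∀ y ∈ (Y : Set V), ¬ (M.graph.mutilate W ∅).IsAnc x y :=
    fun x hx y hy => ADMG.not_isAnc_of_dSep_mutilate (Set.disjoint_union_right.1
      (dXWZ.mono_left h1')).1 (dXY.mono_left h1') (dXWZ.mono_left h1') hZ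
      (hsep.mono subset_rfl h1') hx hy
  have hWB : (W : Set V) ⊆ ((W ∪ X₁ : Finset V) : Set V) := by simp
  have e1 := M.doProb_mul_of_dSep_tails hWB (dXY.mono_left h2) (dXWZ.mono_left h2) dYWZ
    (by rw [Finset.coe_union]; exact ADMG.DSep.mutilate_tails (hsep.mono subset_rfl h2) _) a
  have e2 := M.doProb_mul_of_dSep hWB (dXWZ.mono_left h2) dYWZ
    (by rw [Finset.coe_union]; exact hsep.mono subset_rfl h2) a
  rw [M.doProb_union_eq (S := (Z : Set V)) hZ, M.doProb_union_eq (S := (Y : Set V) ∪ Z)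
    fun x hx s hs => hs.elim (hY x hx s) (hZ x hx s)] at e2
  rw [Finset.union_assoc, Finset.union_sdiff_of_subset h1] at e1
  -- The common factor of `e1` and `e2` to be cancelled.
  have hpos := M.doProb_ne_zero hM (W ∪ X₁) (((X \ X₁ : Finset V) : Set V) ∪ Z) a
  have htop := M.doProb_ne_top (W ∪ X₁) (((X \ X₁ : Finset V) : Set V) ∪ Z) a
  refine (ENNReal.mul_left_inj hpos htop).1 ?_
  rw [mul_right_comm, ← e1, mul_right_comm, e2]
  ring

/-- Soundness of the rules of do-calculus. -/
theorem holdsFor_family (M : SCM.{u, v, w} V Val) (hM : M.Positive) (r : IndepCond V)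
    (h : r.HoldsIn M.graph) : r.HoldsFor (M.family hM) := by
  obtain ⟨kind, X, Y, Z, W, hXY, hXZ, hXW, hYZ, hYW, hZW⟩ := r
  have dXY : Disjoint (X : Set V) Y := by exact_mod_cast hXY
  have dXWZ : Disjoint (X : Set V) (W ∪ Z) :=
    Set.disjoint_union_right.2 ⟨by exact_mod_cast hXW, by exact_mod_cast hXZ⟩
  have dYWZ : Disjoint (Y : Set V) (W ∪ Z) :=
    Set.disjoint_union_right.2 ⟨by exact_mod_cast hYW, by exact_mod_cast hYZ⟩
  intro a
  cases kind
  · refine (M.eval_prob_family hM _ _ _ a).trans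
      (Eq.trans (congrArg ENNReal.toReal ?_) (M.eval_prob_family hM _ _ _ a).symm)
    refine M.doProb_div_eq hM ?_
    have := M.doProb_mul_of_dSep (W := W) subset_rfl dXWZ dYWZ h a
    rwa [Finset.coe_union, ← Set.union_assoc]
  · refine (M.eval_prob_family hM _ _ _ a).trans
      (Eq.trans (congrArg ENNReal.toReal ?_) (M.eval_prob_family hM _ _ _ a).symm)
    refine M.doProb_div_eq hM ?_
    have := M.doProb_mul_of_dSep_tails (W := W) subset_rfl dXY dXWZ dYWZ h a
    rw [Finset.coe_union, ← Set.union_assoc]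
    exact this.symm
  · refine (M.eval_prob_family hM _ _ _ a).trans
      (Eq.trans (congrArg ENNReal.toReal ?_) (M.eval_prob_family hM _ _ _ a).symm)
    exact M.doProb_div_eq hM (M.doProb_mul_of_dSep_heads hM hXY hXW hXZ hYZ hYW h a)

end SCM

theorem Rewrite.eval_eq {V : Type u} [DecidableEq V] {Val : V → Type v}
    [∀ i, MeasurableSpace (Val i)] {r : IndepCond V} {D : IntervFamily V Val} (hr : r.HoldsFor D)
    {s t : Expr V Val} (h : Rewrite r s t) : s.eval D = t.eval D := by
  induction h with
  | refl => rfl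
  | forward a => exact hr a
  | backward a => exact (hr a).symm
  | add _ _ h1 h2 => simp only [Expr.eval, h1, h2]
  | sub _ _ h1 h2 => simp only [Expr.eval, h1, h2]
  | mul _ _ h1 h2 => simp only [Expr.eval, h1, h2]
  | div _ _ h1 h2 => simp only [Expr.eval, h1, h2]
  | sum _ h => simp only [Expr.eval, h]

/-- The conditions of the rules applied in a proof of do-calculus. -/
def DoProof.conds {V : Type u} [DecidableEq V] {Val : V → Type v} [∀ i, MeasurableSpace (Val i)]
    {s t : Expr V Val} : DoProof s t → Set (IndepCond V)
  | .done _ => ∅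
  | .rule r _ p => insert r p.conds
  | .prob _ p => p.conds

theorem DoProof.eval_eq {V : Type u} [DecidableEq V] {Val : V → Type v}
    [∀ i, MeasurableSpace (Val i)] {s t : Expr V Val} (p : DoProof s t) {D : IntervFamily V Val}
    (h : ∀ r ∈ p.conds, r.HoldsFor D) : s.eval D = t.eval D := by
  induction p with
  | done => rfl
  | rule r hr p ih =>
    exact (hr.eval_eq (h r (Set.mem_insert _ _))).trans
      (ih fun r' h' => h r' (Set.mem_insert_of_mem _ h'))
  | prob hp p ih => exact (hp D).trans (ih h)

theorem DoProof.holdsIn_iff {V : Type u} [DecidableEq V] {Val : V → Type v}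
    [∀ i, MeasurableSpace (Val i)] {s t : Expr V Val} (p : DoProof s t) (G : ADMG V) :
    p.HoldsIn G ↔ ∀ r ∈ p.conds, r.HoldsIn G := by
  induction p with
  | done => simp [HoldsIn, conds]
  | rule r hr p ih => simp [HoldsIn, conds, ih]
  | prob hp p ih => simpa [HoldsIn, conds] using ih

theorem ICD.icgc {V : Type u} [DecidableEq V] {Val : V → Type v} [∀ i, MeasurableSpace (Val i)]
    {C : Set (ADMG V)} {Q : CausalQuery V Val} (h : ICD C Q) : ICGC C Q := by
  obtain ⟨t, ht, p, hp⟩ := h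
  exact ⟨⟨p.conds, t, ht, fun D hD => p.eval_eq hD⟩, fun G hG => (p.holdsIn_iff G).1 (hp G hG)⟩

theorem Expr.DoFree.eval_congr {V : Type u} {Val : V → Type v} [∀ i, MeasurableSpace (Val i)]
    {D D' : IntervFamily V Val} (h : ∀ b, D.dist ∅ b = D'.dist ∅ b) {t : Expr V Val}
    (ht : t.DoFree) : t.eval D = t.eval D' := by
  induction t with
  | const => rfl
  | prob A B C a =>
    obtain rfl : B = ∅ := ht
    simp only [Expr.eval, h]
  | add _ _ h1 h2 => simp only [Expr.eval, h1 ht.1, h2 ht.2]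
  | sub _ _ h1 h2 => simp only [Expr.eval, h1 ht.1, h2 ht.2]
  | mul _ _ h1 h2 => simp only [Expr.eval, h1 ht.1, h2 ht.2]
  | div _ _ h1 h2 => simp only [Expr.eval, h1 ht.1, h2 ht.2]
  | sum _ _ h => simp only [Expr.eval, fun s => h s (ht s)]

theorem ICGC.ig {C : Set (ADMG V)} {Q : CausalQuery V Val} (h : ICGC C Q) :
    IG.{u, v, w} C Q := by
  classical
  obtain ⟨K, hK⟩ := h
  have key : ∀ (M : SCM.{u, v, w} V Val) (hM : M.Positive), M.graph ∈ C →
      M.condProb Q.Y Q.X Q.Z Q.val = K.formula.eval (M.family hM) := fun M hM hG => by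
    rw [← M.eval_expr_family hM]
    exact K.sound _ fun r hr => M.holdsFor_family hM r (hK _ hG r hr)
  -- The estimand takes the query's value in any admissible model inducing `P`; the do-free formula
  -- shows that the choice is immaterial. It is also nonnegative and defined for every `P`, which
  -- the formula alone does not ensure.
  refine ⟨fun P => if h : ∃ M : SCM.{u, v, w} V Val, M.Positive ∧ M.graph ∈ C ∧ M.obs = P then
    (h.choose.condProb Q.Y Q.X Q.Z Q.val).toNNReal else 0, fun M hM hG => ?_⟩
  have h : ∃ M' : SCM.{u, v, w} V Val, M'.Positive ∧ M'.graph ∈ C ∧ M'.obs = M.obs :=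
    ⟨M, hM, hG, rfl⟩
  have hs := h.choose_spec
  rw [ValidIn, dif_pos h, Real.coe_toNNReal (h.choose.condProb Q.Y Q.X Q.Z Q.val)
    measureReal_nonneg, key _ hs.1 hs.2.1, key _ hM hG]
  refine K.doFree.eval_congr fun b => ?_
  obtain rfl : b = fun i => absurd i.2 (Finset.notMem_empty _) :=
    funext fun i => absurd i.2 (Finset.notMem_empty _)
  exact hs.2.2

theorem IG.igp {C : Set (ADMG V)} {Q : CausalQuery V Val} (h : IG.{u, v, w} C Q)
    (P : ProbabilityMeasure (∀ i, Val i)) : IGP.{u, v, w} P C Q := by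
  obtain ⟨F, hF⟩ := h
  exact ⟨F, fun M hM hG _ => hF M hM hG⟩

end Soundness

end CausalId

namespace CausalId

/-! ### From a semantic implication to a derivation. -/

section Derivations

variable {V : Type u} {Val : V → Type v}

/-- Hence every criterion has finitely many conditions, as a finite derivation requires. -/
instance [Finite V] : Finite (IndepCond V) := by
  have : Finite RuleKind := Finite.of_injective
    (fun k => match k with | .R1 => (0 : Fin 3) | .R2 => 1 | .R3 => 2) fun k l => by
      cases k <;> cases l <;> simp
  refine Finite.of_injective
    (β := RuleKind × Finset V × Finset V × Finset V × Finset V)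
    (fun r => (r.kind, r.X, r.Y, r.Z, r.W)) fun r s h => ?_
  cases r
  cases s
  simpa using h

/-- The sum over all joint values, with the weights `wt`, of the squared differences between two
expressions depending on a joint value. -/
def Expr.defect [Fintype V] (wt : (∀ i : (Finset.univ : Finset V), Val i) → ℝ)
    (f g : (∀ i, Val i) → Expr V Val) : Expr V Val :=
  .sum Finset.univ fun s => .mul (.const (wt s))
    (.mul (.sub (f fun i => s ⟨i, Finset.mem_univ i⟩) (g fun i => s ⟨i, Finset.mem_univ i⟩))
      (.sub (f fun i => s ⟨i, Finset.mem_univ i⟩) (g fun i => s ⟨i, Finset.mem_univ i⟩)))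

theorem IndepCond.rewrite_defect [Fintype V] [DecidableEq V] (r : IndepCond V)
    (wt : (∀ i : (Finset.univ : Finset V), Val i) → ℝ) :
    Rewrite r (Expr.defect wt r.lhs r.rhs) (Expr.defect wt r.rhs r.rhs) :=
  .sum fun _ => .mul (.refl _)
    (.mul (.sub (.forward _) (.refl _)) (.sub (.forward _) (.refl _)))

variable [∀ i, MeasurableSpace (Val i)]

theorem Expr.eval_prob_nonneg (D : IntervFamily V Val) (A B C : Finset V) (a : ∀ i, Val i) :
    0 ≤ (Expr.prob A B C a).eval D :=
  measureReal_nonneg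

theorem Expr.eval_prob_le_one (D : IntervFamily V Val) (A B C : Finset V) (a : ∀ i, Val i) :
    (Expr.prob A B C a).eval D ≤ 1 :=
  measureReal_le_one

theorem Expr.eval_defect_self [Fintype V] (wt : (∀ i : (Finset.univ : Finset V), Val i) → ℝ)
    (g : (∀ i, Val i) → Expr V Val) (D : IntervFamily V Val) : (defect wt g g).eval D = 0 := by
  simp [defect, Expr.eval]

variable [DecidableEq V]

theorem IndepCond.eval_lhs_mem (r : IndepCond V) (D : IntervFamily V Val) (a : ∀ i, Val i) :
    0 ≤ (r.lhs a).eval D ∧ (r.lhs a).eval D ≤ 1 := by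
  obtain ⟨kind, _⟩ := r
  cases kind <;> exact ⟨Expr.eval_prob_nonneg .., Expr.eval_prob_le_one ..⟩

theorem IndepCond.eval_rhs_mem (r : IndepCond V) (D : IntervFamily V Val) (a : ∀ i, Val i) :
    0 ≤ (r.rhs a).eval D ∧ (r.rhs a).eval D ≤ 1 := by
  obtain ⟨kind, _⟩ := r
  cases kind <;> exact ⟨Expr.eval_prob_nonneg .., Expr.eval_prob_le_one ..⟩

/-- Squared differences of probabilities are at most 1, so summable weights guarantee convergence.
Otherwise a divergent sum, counted as 0, would look like a rule that holds. Positive weights then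
force every difference to vanish. -/
theorem IndepCond.holdsFor_of_eval_defect [Fintype V] (r : IndepCond V)
    {wt : (∀ i : (Finset.univ : Finset V), Val i) → ℝ} (hpos : ∀ s, 0 < wt s) (hwt : Summable wt)
    {D : IntervFamily V Val} (h : (Expr.defect wt r.lhs r.rhs).eval D = 0) : r.HoldsFor D := by
  set F : (∀ i : (Finset.univ : Finset V), Val i) → ℝ := fun s => wt s *
    (((r.lhs fun i => s ⟨i, Finset.mem_univ i⟩).eval D -
      (r.rhs fun i => s ⟨i, Finset.mem_univ i⟩).eval D) *
    ((r.lhs fun i => s ⟨i, Finset.mem_univ i⟩).eval D -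
      (r.rhs fun i => s ⟨i, Finset.mem_univ i⟩).eval D))
    with hF
  have h0 : ∀ s, 0 ≤ F s := fun s => mul_nonneg (hpos s).le (mul_self_nonneg _)
  have hsum : Summable F := by
    refine Summable.of_nonneg_of_le h0 (fun s => ?_) hwt
    have h1 := r.eval_lhs_mem D fun i => s ⟨i, Finset.mem_univ i⟩
    have h2 := r.eval_rhs_mem D fun i => s ⟨i, Finset.mem_univ i⟩
    refine mul_le_of_le_one_right (hpos s).le ?_
    nlinarith
  have hz : F = 0 := by
    have h' : ∑' s, F s = 0 := h
    exact (hasSum_zero_iff_of_nonneg h0).1 (h' ▸ hsum.hasSum)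
  intro a
  have := congrFun hz fun i => a i
  simp only [hF, Pi.zero_apply, mul_eq_zero, (hpos _).ne', false_or, or_self] at this
  exact sub_eq_zero.1 this

variable [Finite V] [∀ i, Countable (Val i)]

/-- An equality that holds in all interventional families satisfying finitely many rules can be
derived by do-calculus from these rules. -/
theorem exists_doProof_of_conds {C : Set (ADMG V)} (l : List (IndepCond V))
    (hl : ∀ r ∈ l, ∀ G ∈ C, r.HoldsIn G) {s t t' : Expr V Val}
    (h : ∀ D : IntervFamily V Val, (∀ r ∈ l, r.HoldsFor D) → s.eval D = t.eval D)
    (q : DoProof t t') (hq : ∀ G ∈ C, q.HoldsIn G) :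
    ∃ p : DoProof s t', ∀ G ∈ C, p.HoldsIn G := by
  have := Fintype.ofFinite V
  obtain ⟨wt, hpos, c, hc, -⟩ :=
    NNReal.exists_pos_sum_of_countable one_ne_zero (∀ i : (Finset.univ : Finset V), Val i)
  have hwt : Summable fun s => (wt s : ℝ) := NNReal.summable_coe.2 hc.summable
  induction l generalizing t with
  | nil => exact ⟨.prob (fun D => h D (List.forall_mem_nil _)) q, hq⟩
  | cons r l ih =>
    -- The rule `r` is removed by passing from `s` to `t + (s - t) * (δ / δ)`. If `δ ≠ 0` this is
    -- `s`. If `δ = 0`, then `r` holds and, with the remaining rules, `s = t`. Rewriting with `r`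
    -- replaces `δ` by `δ'`, which is always 0.
    let δ : Expr V Val := Expr.defect (fun s => (wt s : ℝ)) r.lhs r.rhs
    let δ' : Expr V Val := Expr.defect (fun s => (wt s : ℝ)) r.rhs r.rhs
    have hrw : Rewrite r (.add t (.mul (.sub s t) (.div δ δ)))
        (.add t (.mul (.sub s t) (.div δ' δ'))) :=
      .add (.refl _) (.mul (.refl _) (.div (r.rewrite_defect _) (r.rewrite_defect _)))
    have hprob : ProbEq (.add t (.mul (.sub s t) (.div δ' δ'))) t := fun D => by
      simp [Expr.eval, δ', Expr.eval_defect_self]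
    refine ih (fun r' hr' => hl r' (List.mem_cons_of_mem _ hr')) (fun D hD => ?_)
      (.rule r hrw (.prob hprob q)) fun G hG => ⟨hl r List.mem_cons_self G hG, hq G hG⟩
    by_cases hδ : δ.eval D = 0
    · have := h D (List.forall_mem_cons.2
        ⟨r.holdsFor_of_eval_defect (fun s => NNReal.coe_pos.2 (hpos s)) hwt hδ, hD⟩)
      simp [Expr.eval, hδ, this]
    · simp [Expr.eval, div_self hδ]

theorem ICGC.icd {C : Set (ADMG V)} {Q : CausalQuery V Val} (h : ICGC C Q) : ICD C Q := by
  obtain ⟨K, hK⟩ := h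
  have hfin := K.conds.toFinite
  refine ⟨K.formula, K.doFree, exists_doProof_of_conds hfin.toFinset.toList
    (fun r hr G hG => hK G hG r (by simpa using hr)) (fun D hD => K.sound D fun r hr => hD r ?_)
    (.done _) fun _ _ => trivial⟩
  simpa using hr

end Derivations

end CausalId

namespace CausalId

/-! ### The backdoor and frontdoor criteria. -/

section Criteria

namespace ADMG

variable {V : Type u} {G : ADMG V}

theorem HasArrow.notMem_of_headAtStart {H T : Set V} {i j : V} {e : Arrow}
    (h : (G.mutilate H T).HasArrow i e j) (he : e.HeadAtStart) : i ∉ H := by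
  cases e
  · exact he.elim
  · exact h.2.1
  · exact h.2.1

theorem HasArrow.headAtStart_of_mem {H T : Set V} {i j : V} {e : Arrow}
    (h : (G.mutilate H T).HasArrow i e j) (hi : i ∈ T) : e.HeadAtStart := by
  cases e
  · exact h.2.2 hi
  · trivial
  · trivial

theorem eq_of_isAnc_mutilate {H T : Set V} {i j : V} (h : (G.mutilate H T).IsAnc i j)
    (hj : j ∈ H) : i = j := by
  rcases Relation.ReflTransGen.cases_tail h with h | ⟨k, -, hk⟩
  · exact h.symm
  · exact absurd hj hk.2.1

theorem Path.isDirected_of_forall_not_isCollider (p : G.Path)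
    (hc : ∀ k ≤ p.length, ¬ p.IsCollider k) (h0 : 0 < p.length → ¬ (p.edge 0).HeadAtStart) :
    p.IsDirected := by
  intro k
  induction k with
  | zero => exact fun h => Arrow.eq_right_of_not_headAtStart (h0 h)
  | succ k ih =>
    intro hk
    refine Arrow.eq_right_of_not_headAtStart fun h => hc (k + 1) hk.le ⟨by omega, hk, ?_, h⟩
    rw [Nat.add_sub_cancel, ih (by omega)]
    trivial

theorem Path.IsDirected.isAnc {p : G.Path} (h : p.IsDirected) : G.IsAnc p.first p.last := by
  have : ∀ k ≤ p.length, G.IsAnc p.first (p.vert k) := by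
    intro k
    induction k with
    | zero => exact fun _ => .refl
    | succ k ih =>
      intro hk
      have h1 := p.hasArrow k hk
      rw [h k hk] at h1
      exact (ih (by omega)).tail h1
  exact this _ le_rfl

theorem Path.length_pos {p : G.Path} {A B : Set V} (hAB : Disjoint A B) (h0 : p.first ∈ A)
    (h1 : p.last ∈ B) : 0 < p.length := by
  rcases Nat.eq_zero_or_pos p.length with h | h
  · rw [Path.last, h] at h1
    exact absurd h1 (Set.disjoint_left.1 hAB h0)
  · exact h

theorem mutilate_dir_le (H T : Set V) (i j : V) (h : (G.mutilate H T).dir i j) : G.dir i j := h.1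

theorem mutilate_bi_le (H T : Set V) (i j : V) (h : (G.mutilate H T).bi i j) : G.bi i j := h.1

/-- If the backdoor paths from `A` to `B` are blocked, then `A` and `B` are separated in the graph
without the arrows out of `A`. -/
theorem dSep_mutilate_of_backdoor {A B Z : Set V} (H : Set V) (hAB : Disjoint A B)
    (h : ∀ p : G.Path, p.first ∈ A → p.last ∈ B → p.IsBackdoor → ¬ p.Active Z) :
    (G.mutilate H A).DSep B A Z := by
  refine DSep.symm fun p h0 h1 hp => ?_
  have hlen := p.length_pos hAB h0 h1
  exact h (p.map (mutilate_dir_le H A) (mutilate_bi_le H A)) h0 h1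
    ⟨hlen, (p.hasArrow 0 hlen).headAtStart_of_mem h0⟩
    (hp.map (mutilate_dir_le H A) (mutilate_bi_le H A))

/-- A path from `A`, all of whose colliders are ancestors of `S`, is directed and avoids `S` in a
graph without arrows into `A` and `S`. -/
theorem Path.Active.isDirected {A S H T : Set V} {p : (G.mutilate H T).Path} (hA : A ⊆ H)
    (hS : S ⊆ H) (h0 : p.first ∈ A) (hp : p.Active S) :
    p.IsDirected ∧ ∀ k ≤ p.length, p.vert k ∉ S := by
  have hc : ∀ k ≤ p.length, ¬ p.IsCollider k := by
    intro k hk hcol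
    obtain ⟨s, hs, hs'⟩ := (hp k hk).1 hcol
    -- No arrow enters `S`, so a collider that is an ancestor of `S` lies in `S`, yet a collider has
    -- incoming arrows.
    have h1 := eq_of_isAnc_mutilate hs' (hS hs)
    exact (p.hasArrow k hcol.2.1).notMem_of_headAtStart hcol.2.2.2 (h1 ▸ hS hs)
  exact ⟨p.isDirected_of_forall_not_isCollider hc fun hlen h =>
    (p.hasArrow 0 hlen).notMem_of_headAtStart h (hA h0), fun k hk => (hp k hk).2 (hc k hk)⟩

theorem dSep_mutilate_of_not_isAnc {A B H : Set V} (hA : A ⊆ H)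
    (h : ∀ b ∈ B, ∀ a ∈ A, ¬ G.IsAnc a b) : (G.mutilate H ∅).DSep B A ∅ := by
  refine DSep.symm fun p h0 h1 hp => ?_
  have h2 := (hp.isDirected hA (Set.empty_subset H) h0).1.isAnc
  exact h _ h1 _ h0 (h2.mono (mutilate_dir_le H ∅))

theorem dSep_mutilate_of_intercept {A B S H : Set V} (hA : A ⊆ H) (hS : S ⊆ H)
    (h : ∀ p : G.Path, p.first ∈ A → p.last ∈ B → p.IsDirected →
      ∃ k, k ≤ p.length ∧ p.vert k ∈ S) : (G.mutilate H ∅).DSep B A S := by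
  refine DSep.symm fun p h0 h1 hp => ?_
  obtain ⟨h2, h3⟩ := hp.isDirected hA hS h0
  obtain ⟨k, hk, hk'⟩ := h (p.map (mutilate_dir_le H ∅) (mutilate_bi_le H ∅)) h0 h1 h2
  exact h3 k hk hk'

theorem dSep_mutilate_heads_of_backdoor {A B H : Set V} (hB : B ⊆ H) (hAB : Disjoint A B)
    (h : ∀ p : G.Path, p.first ∈ A → p.last ∈ B → p.IsBackdoor → ¬ p.Active ∅) :
    (G.mutilate H ∅).DSep A B ∅ := by
  intro p h0 h1 hp
  have hlen := p.length_pos hAB h0 h1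
  refine h (p.map (mutilate_dir_le H ∅) (mutilate_bi_le H ∅)) h0 h1 ⟨hlen, ?_⟩
    (hp.map (mutilate_dir_le H ∅) (mutilate_bi_le H ∅))
  -- Traversed from `B`, the path is directed. Its last arrow thus points into the first vertex of
  -- `p`, which makes `p` a backdoor path.
  have h2 := (Path.Active.isDirected (p := p.reverse) hB (Set.empty_subset H) h1
    hp.reverse).1 (p.length - 1)
    (by change _ < p.length; omega)
  change (p.edge (p.length - (p.length - 1 + 1))).reverse = _ at h2
  rw [show p.length - (p.length - 1 + 1) = 0 by omega] at h2
  change (p.edge 0).HeadAtStart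
  rw [← Arrow.headAtEnd_reverse, h2]
  trivial

end ADMG

variable {V : Type u} [DecidableEq V] {Val : V → Type v}

/-- The joint value `a` with the values of the variables in `S` replaced by `s`. -/
def override (S : Finset V) (s : ∀ i : S, Val i) (a : ∀ i, Val i) : ∀ i, Val i :=
  fun i => if h : i ∈ S then s ⟨i, h⟩ else a i

theorem override_of_mem {S : Finset V} (s : ∀ i : S, Val i) (a : ∀ i, Val i) {i : V} (h : i ∈ S) :
    override S s a i = s ⟨i, h⟩ := dif_pos h

theorem override_of_notMem {S : Finset V} (s : ∀ i : S, Val i) (a : ∀ i, Val i) {i : V}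
    (h : i ∉ S) : override S s a i = a i := dif_neg h

variable [Finite V] [∀ i, Countable (Val i)]
  [∀ i, MeasurableSpace (Val i)] [∀ i, MeasurableSingletonClass (Val i)]

/-- The law of total probability. -/
theorem eval_prob_eq_tsum (D : IntervFamily V Val) {A B S : Finset V} (hAS : Disjoint A S)
    (hBS : Disjoint B S) (a : ∀ i, Val i) : (Expr.prob A B ∅ a).eval D =
      ∑' s : ∀ i : S, Val i, (Expr.prob A B S (override S s a)).eval D *
        (Expr.prob S B ∅ (override S s a)).eval D := by
  have hB : ∀ s, (fun i : B => override S s a i) = fun i : B => a i := fun s =>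
    funext fun i => override_of_notMem s a (Finset.disjoint_left.1 hBS i.2)
  have hA : ∀ s, cyl A (override S s a) = cyl A a := fun s => Set.ext fun ω =>
    forall₂_congr fun i hi => by rw [override_of_notMem s a (Finset.disjoint_left.1 hAS hi)]
  have hE : ∀ b : ∀ i, Val i, cyl ∅ b = Set.univ := fun b => by simp [cyl]
  simp only [Expr.eval, hB, hA, hE, ProbabilityTheory.cond_univ]
  rw [Measure.real, measure_eq_tsum_inter_preimage (D.dist B fun i => a i : Measure (∀ i, Val i))
    (f := fun (ω : ∀ i, Val i) (i : S) => ω i)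
    (measurable_pi_lambda _ fun i => measurable_pi_apply _), ENNReal.tsum_toReal_eq
    fun s => measure_ne_top _ _]
  refine tsum_congr fun s => ?_
  have hS : (fun (ω : ∀ i, Val i) (i : S) => ω i) ⁻¹' {s} = cyl S (override S s a) := by
    ext ω
    constructor
    · rintro rfl i hi
      exact (override_of_mem (fun i : S => ω i) a hi).symm
    · intro h
      funext i
      exact (h i i.2).trans (override_of_mem s a i.2)
  rw [hS, Measure.real, Measure.real, ← ENNReal.toReal_mul, Set.inter_comm,
    ProbabilityTheory.cond_mul_eq_inter MeasurableSet.of_discrete]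

theorem eval_prob_eq_div (D : IntervFamily V Val) (A B C : Finset V) (a : ∀ i, Val i) :
    (Expr.prob A B C a).eval D =
      (Expr.prob (A ∪ C) B ∅ a).eval D / (Expr.prob C B ∅ a).eval D := by
  have hE : cyl ∅ a = Set.univ := by simp [cyl]
  simp only [Expr.eval, hE, ProbabilityTheory.cond_univ]
  rw [Measure.real, ProbabilityTheory.cond_apply MeasurableSet.of_discrete, ENNReal.toReal_mul,
    ENNReal.toReal_inv, mul_comm, ← div_eq_mul_inv]
  congr 3
  ext ω
  simp only [cyl, Set.mem_inter_iff, Set.mem_ofPred_eq, Finset.mem_union]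
  exact ⟨fun h i hi => hi.elim (h.2 i) (h.1 i), fun h => ⟨fun i hi => h i (Or.inr hi),
    fun i hi => h i (Or.inl hi)⟩⟩

/-- The adjustment formula for `P(t | do(x))`. -/
def backdoorExpr (X S T : Finset V) (a : ∀ i, Val i) : Expr V Val :=
  .sum S fun s => .mul (.prob T ∅ (X ∪ S) (override S s a)) (.prob S ∅ ∅ (override S s a))

theorem eval_backdoorExpr {D : IntervFamily V Val} {X S T : Finset V} (hXS : Disjoint X S)
    (hTS : Disjoint T S)
    (h1 : ∀ a, (Expr.prob T (∅ ∪ X) S a).eval D = (Expr.prob T ∅ (X ∪ S) a).eval D)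
    (h2 : ∀ a, (Expr.prob S (∅ ∪ X) ∅ a).eval D = (Expr.prob S ∅ ∅ a).eval D) (a : ∀ i, Val i) :
    (Expr.prob T X ∅ a).eval D = (backdoorExpr X S T a).eval D := by
  simp only [Finset.empty_union] at h1 h2
  rw [eval_prob_eq_tsum D hTS hXS]
  exact tsum_congr fun s => congrArg₂ (· * ·) (h1 _) (h2 _)

/-- R2 exchanges `do(x)` for `x` in `P(t | do(x), s)`, since the backdoor paths are blocked. R3
gives `P(s | do(x)) = P(s)`, since `S` contains no descendant of `X`. R2 is needed both for `T = Y ∪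
Z` and for `T = Z`. -/
theorem ICB.icgc {C : Set (ADMG V)} {Q : CausalQuery V Val} (h : ICB C Q) : ICGC C Q := by
  obtain ⟨S, hS, hC⟩ := h
  obtain ⟨X, Y, Z, hXY, hXZ, hYZ, a⟩ := Q
  change Disjoint S (X ∪ Y ∪ Z) at hS
  rw [Finset.disjoint_union_right, Finset.disjoint_union_right] at hS
  obtain ⟨⟨hSX, hSY⟩, hSZ⟩ := hS
  have hXT : Disjoint X (Y ∪ Z) := Finset.disjoint_union_right.2 ⟨hXY, hXZ⟩
  have hTS : Disjoint (Y ∪ Z) S := Finset.disjoint_union_left.2 ⟨hSY.symm, hSZ.symm⟩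
  let r₁ : IndepCond V := ⟨.R2, X, Y ∪ Z, S, ∅, hXT, hSX.symm, by simp, hTS, by simp, by simp⟩
  let r₂ : IndepCond V := ⟨.R2, X, Z, S, ∅, hXZ, hSX.symm, by simp, hSZ.symm, by simp, by simp⟩
  let r₃ : IndepCond V := ⟨.R3, X, S, ∅, ∅, hSX.symm, by simp, by simp, by simp, by simp, by simp⟩
  refine ⟨⟨{r₁, r₂, r₃}, .div (backdoorExpr X S (Y ∪ Z) a) (backdoorExpr X S Z a), ?_, ?_⟩, ?_⟩
  · simp [backdoorExpr, Expr.DoFree]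
  · intro D hD
    have h1 := hD r₁ (by simp)
    have h2 := hD r₂ (by simp)
    have h3 := hD r₃ (by simp)
    refine (eval_prob_eq_div D Y X Z a).trans ?_
    rw [eval_backdoorExpr hSX.symm hTS h1 h3, eval_backdoorExpr hSX.symm hSZ.symm h2 h3]
    rfl
  · intro G hG r hr
    obtain ⟨hdesc, hback⟩ := hC G hG
    have key : ∀ T : Finset V, T ⊆ Y ∪ Z → Disjoint X T →
        (G.mutilate (∅ : Finset V) X).DSep T X ((∅ : Finset V) ∪ S) := by
      intro T hT hXT
      rw [Finset.coe_empty, Set.empty_union]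
      exact ADMG.dSep_mutilate_of_backdoor _ (by exact_mod_cast hXT)
        fun p h0 h1 => hback p h0 (by simpa using hT h1)
    rcases hr with rfl | rfl | rfl
    · exact key _ subset_rfl hXT
    · exact key _ Finset.subset_union_right hXZ
    · have := ADMG.dSep_mutilate_of_not_isAnc (G := G) (A := X) (B := S)
        (H := (∅ : Finset V) ∪
          {x | x ∈ X ∧ ∀ z ∈ (∅ : Finset V), ¬ (G.mutilate (∅ : Finset V) ∅).IsAnc x z})
        (fun x hx => Or.inr ⟨hx, by simp⟩) hdesc
      simpa [IndepCond.HoldsIn, IndepCond.mutilated, r₃] using this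

/-- The frontdoor formula for `P(t | do(x))`. -/
def frontdoorExpr (X S T : Finset V) (a : ∀ i, Val i) : Expr V Val :=
  .sum S fun s => .mul
    (.sum X fun x => .mul (.prob T ∅ (S ∪ X) (override X x (override S s a)))
      (.prob X ∅ ∅ (override X x (override S s a))))
    (.prob S ∅ (X ∪ ∅) (override S s a))

/-- After summing over `s`, `h1` makes `P(s | do(x))` observational, while `h2` and `h3` turn `P(t |
do(x), s)` into `P(t | do(s))`. The latter is expanded over fresh values of `X` and made do-free by
`h4` and `h5`. -/
theorem eval_frontdoorExpr {D : IntervFamily V Val} {X S T : Finset V} (hXS : Disjoint X S)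
    (hTS : Disjoint T S) (hTX : Disjoint T X)
    (h1 : ∀ a, (Expr.prob S (∅ ∪ X) ∅ a).eval D = (Expr.prob S ∅ (X ∪ ∅) a).eval D)
    (h2 : ∀ a, (Expr.prob T (X ∪ S) ∅ a).eval D = (Expr.prob T X (S ∪ ∅) a).eval D)
    (h3 : ∀ a, (Expr.prob T (S ∪ X) ∅ a).eval D = (Expr.prob T S ∅ a).eval D)
    (h4 : ∀ a, (Expr.prob X (∅ ∪ S) ∅ a).eval D = (Expr.prob X ∅ ∅ a).eval D)
    (h5 : ∀ a, (Expr.prob T (∅ ∪ S) X a).eval D = (Expr.prob T ∅ (S ∪ X) a).eval D)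
    (a : ∀ i, Val i) : (Expr.prob T X ∅ a).eval D = (frontdoorExpr X S T a).eval D := by
  simp only [Finset.empty_union] at h1 h4 h5
  simp only [Finset.union_empty] at h2
  rw [eval_prob_eq_tsum D hTS hXS]
  refine tsum_congr fun s => congrArg₂ (· * ·) ?_ (h1 _)
  rw [← h2, Finset.union_comm, h3, eval_prob_eq_tsum D hTX hXS.symm]
  exact tsum_congr fun x => congrArg₂ (· * ·) (h5 _) (h4 _)

theorem ICF.icgc {C : Set (ADMG V)} {Q : CausalQuery V Val} (h : ICF C Q) : ICGC C Q := by
  obtain ⟨S, hS, hC⟩ := h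
  obtain ⟨X, Y, Z, hXY, hXZ, hYZ, a⟩ := Q
  change Disjoint S (X ∪ Y ∪ Z) at hS
  rw [Finset.disjoint_union_right, Finset.disjoint_union_right] at hS
  obtain ⟨⟨hSX, hSY⟩, hSZ⟩ := hS
  have hXT : Disjoint X (Y ∪ Z) := Finset.disjoint_union_right.2 ⟨hXY, hXZ⟩
  have hTS : Disjoint (Y ∪ Z) S := Finset.disjoint_union_left.2 ⟨hSY.symm, hSZ.symm⟩
  -- `r₁` and `r₄` come from the backdoor paths between `X` and `S`, `r₂` and `r₅` from those
  -- between `S` and `T` blocked by `X`, and `r₃` from the interception of directed paths.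
  let r₁ : IndepCond V := ⟨.R2, X, S, ∅, ∅, hSX.symm, by simp, by simp, by simp, by simp, by simp⟩
  let r₄ : IndepCond V := ⟨.R3, S, X, ∅, ∅, hSX, by simp, by simp, by simp, by simp, by simp⟩
  let r₂ (T : Finset V) (hS : Disjoint T S) (hX : Disjoint X T) : IndepCond V :=
    ⟨.R2, S, T, ∅, X, hS.symm, by simp, hSX, by simp, hX.symm, by simp⟩
  let r₃ (T : Finset V) (hS : Disjoint T S) (hX : Disjoint X T) : IndepCond V :=
    ⟨.R3, X, T, ∅, S, hX, by simp, hSX.symm, by simp, hS, by simp⟩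
  let r₅ (T : Finset V) (hS : Disjoint T S) (hX : Disjoint X T) : IndepCond V :=
    ⟨.R2, S, T, X, ∅, hS.symm, hSX, by simp, hX.symm, by simp, by simp⟩
  refine ⟨⟨{r₁, r₄} ∪ {r | ∃ (T : Finset V) (hS : Disjoint T S) (hX : Disjoint X T), T ⊆ Y ∪ Z ∧
      (r = r₂ T hS hX ∨ r = r₃ T hS hX ∨ r = r₅ T hS hX)},
    .div (frontdoorExpr X S (Y ∪ Z) a) (frontdoorExpr X S Z a), ?_, ?_⟩, ?_⟩
  · simp [frontdoorExpr, Expr.DoFree]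
  · intro D hD
    have h1 := hD r₁ (by simp)
    have h4 := hD r₄ (by simp)
    have key : ∀ T, Disjoint T S → Disjoint X T → T ⊆ Y ∪ Z →
        (Expr.prob T X ∅ a).eval D = (frontdoorExpr X S T a).eval D := fun T hS hX hT =>
      eval_frontdoorExpr hSX.symm hS hX.symm h1
        (hD (r₂ T hS hX) (Or.inr ⟨T, hS, hX, hT, Or.inl rfl⟩))
        (hD (r₃ T hS hX) (Or.inr ⟨T, hS, hX, hT, Or.inr (Or.inl rfl)⟩)) h4
        (hD (r₅ T hS hX) (Or.inr ⟨T, hS, hX, hT, Or.inr (Or.inr rfl)⟩)) a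
    refine (eval_prob_eq_div D Y X Z a).trans ?_
    rw [key _ hTS hXT subset_rfl, key _ hSZ.symm hXZ Finset.subset_union_right]
    rfl
  · intro G hG r hr
    obtain ⟨hint, hXS, hST⟩ := hC G hG
    have dSX : Disjoint (S : Set V) X := by exact_mod_cast hSX
    rcases hr with (rfl | rfl) | ⟨T, hS, hX, hT, hr⟩
    · have := ADMG.dSep_mutilate_of_backdoor (∅ : Finset V) dSX.symm hXS
      simpa [IndepCond.HoldsIn, IndepCond.mutilated, r₁] using this
    · have := ADMG.dSep_mutilate_heads_of_backdoor (G := G) (A := X) (B := S) (H := S)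
        subset_rfl dSX.symm hXS
      simpa [IndepCond.HoldsIn, IndepCond.mutilated, r₄] using this
    · have hT' : (T : Set V) ⊆ Y ∪ Z := fun i hi => by simpa using hT hi
      have dST : Disjoint (S : Set V) T := by exact_mod_cast hS.symm
      have hST' : ∀ p : G.Path, p.first ∈ (S : Set V) → p.last ∈ (T : Set V) → p.IsBackdoor →
          ¬ p.Active X := fun p h0 h1 => hST p h0 (hT' h1)
      rcases hr with rfl | rfl | rfl
      · have := ADMG.dSep_mutilate_of_backdoor (X : Set V) dST hST'
        simpa [IndepCond.HoldsIn, IndepCond.mutilated, r₂] using this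
      · have := ADMG.dSep_mutilate_of_intercept (G := G) (A := X) (B := T) (S := S) (H := S ∪ X)
          Set.subset_union_right Set.subset_union_left fun p h0 h1 => hint p h0 (hT' h1)
        simpa [IndepCond.HoldsIn, IndepCond.mutilated, r₃] using this
      · have := ADMG.dSep_mutilate_of_backdoor (∅ : Set V) dST hST'
        simpa [IndepCond.HoldsIn, IndepCond.mutilated, r₅] using this

end Criteria

end CausalId

theorem mainTheorem1 {V : Type u} [Finite V] [DecidableEq V] {Val : V → Type v}
    [∀ i, Countable (Val i)] [∀ i, MeasurableSpace (Val i)]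
    [∀ i, MeasurableSingletonClass (Val i)]
    (C : Set (CausalId.ADMG V)) (Q : CausalId.CausalQuery V Val) :
    (∀ 𝒦 : Set (CausalId.GraphicalCriterion Q),
      CausalId.IdentByCommonSpecific C Q 𝒦 → CausalId.ICGC C Q) ∧
    (CausalId.ICB C Q → CausalId.ICGC C Q) ∧
    (CausalId.ICF C Q → CausalId.ICGC C Q) ∧
    (CausalId.ICGC C Q ↔ CausalId.ICD C Q) ∧
    (CausalId.ICD C Q → CausalId.IG.{u, v, w} C Q) ∧
    (CausalId.IG.{u, v, w} C Q →
      ∀ P : ProbabilityMeasure (∀ i, Val i), CausalId.IGP.{u, v, w} P C Q) := by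
  exact ⟨fun _ ⟨K, _, hK⟩ => ⟨K, hK⟩, CausalId.ICB.icgc, CausalId.ICF.icgc,
    ⟨CausalId.ICGC.icd, CausalId.ICD.icgc⟩, fun h => h.icgc.ig, CausalId.IG.igp⟩
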